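/- Let $k$ be a field, let $G$ be an abelian group, let $A$ be a $G$-graded associative unital $k$-algebra, and let $\phi\colon G\to H$ be a morphism to an arbitrary group $H$, with kernel $L=\ker\phi$. For a $G$-graded left $A$-module $M=\bigoplus_{g\in G}M_g$ let $\phi_!(M)$ be the same $A$-module with the $H$-grading $\phi_!(M)_h=\bigoplus_{\phi(g)=h}M_g$; in particular $\phi_!(A)$ is an $H$-graded algebra, again written $A$, and $\phi_!$ is an exact functor from the category of $G$-graded $A$-modules (with degree-preserving $A$-linear maps) to the category of $H$-graded $A$-modules. Call $M$ *$\phi$-finite* if $\{g\in G : M_g\neq 0,\ \phi(g)=h\}$ is finite for every $h\in H$. Say that $A$ is *left $G$-graded noetherian* if every graded submodule of a finitely generated $G$-graded left $A$-module is finitely generated. For a bounded complex $R^\bullet$ of $G$-graded (resp. $H$-graded) $A$-modules let $\operatorname{injdim}^G_A R^\bullet$ (resp. $\operatorname{injdim}^H_A R^\bullet$) $\in\mathbb Z\cup\{\pm\infty\}$ be the infimum of the integers $n$ for which there is a quasi-isomorphism $R^\bullet\to I^\bullet$ to a bounded below complex of injective objects of the respective category of graded modules with $I^i=0$ for all $i>n$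 (so it is $-\infty$ if $R^\bullet$ is acyclic, and $+\infty$ if there is no such $n$). Let $d=\operatorname{projdim}_{k[L]}k\in\mathbb N\cup\{\infty\}$ be the projective dimension of the trivial module over the group algebra of $L$. Let $R^\bullet$ be a bounded complex of $G$-graded left $A$-modules. 1. If all cohomology modules $H^i(R^\bullet)$ are $\phi$-finite, then $\operatorname{injdim}^G_A R^\bullet=\operatorname{injdim}^H_A\phi_!(R^\bullet)$. 2. If $A$ is left $G$-graded noetherian, then $$\operatorname{injdim}^G_A R^\bullet\le \operatorname{injdim}^H_A\phi_!(R^\bullet)\le \operatorname{injdim}^G_A R^\bullet+d,$$ where $-\infty+\infty=-\infty$ (relevant only if $R^\bullet$ is acyclic). -/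

import Mathlib

open CategoryTheory CategoryTheory.Limits

universe u

namespace GradedInjDim

section Linear

variable {k G M N : Type u} [Field k] [AddCommGroup M] [Module k M] [AddCommGroup N] [Module k N]

/-- A family `V` of `k`-submodules of `M` is a `G`-grading of `M` if `M` is the (internal) direct
sum of the `V g`, i.e. the `V g` are independent and they span `M`. -/
structure IsGrading (V : G → Submodule k M) : Prop where
  indep : iSupIndep V
  iSup_eq_top : ⨆ g, V g = ⊤

/-- A graded module has projections onto its homogeneous components. -/
lemma IsGrading.exists_proj {V : G → Submodule k M} (hV : IsGrading V) :
    ∃ p : G → M →ₗ[k] M, (∀ g m, p g m ∈ V g) ∧ (∀ g, ∀ m ∈ V g, p g m = m) ∧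
      (∀ g g', g ≠ g' → ∀ m ∈ V g', p g m = 0) ∧
      (∀ m, ∃ s : Finset G, m = ∑ g ∈ s, p g m) := by
  classical
  have hint := DirectSum.isInternal_submodule_of_iSupIndep_of_iSup_eq_top hV.indep hV.iSup_eq_top
  let e := LinearEquiv.ofBijective (DirectSum.coeLinearMap V) hint
  have he : ∀ g (m : V g), e.symm m = DirectSum.lof k G (fun g => V g) g m := by
    intro g m
    rw [LinearEquiv.symm_apply_eq]
    exact (DirectSum.coeLinearMap_lof V g m).symm
  refine ⟨fun g => (V g).subtype ∘ₗ DirectSum.component k G (fun g => V g) g ∘ₗ e.symm.toLinearMap,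
    ?_, ?_, ?_, ?_⟩
  · intro g m
    simp
  · intro g m hm
    have := he g ⟨m, hm⟩
    simp only at this
    simp [this, DirectSum.component.lof_self]
  · intro g g' hgg m hm
    have := he g' ⟨m, hm⟩
    simp only at this
    simp only [LinearMap.comp_apply, LinearEquiv.coe_coe, this, DirectSum.component.of]
    rw [dif_neg hgg.symm]
    simp
  · intro m
    obtain ⟨x, rfl⟩ := e.surjective m
    refine ⟨DFinsupp.support x, ?_⟩
    simp only [LinearMap.comp_apply, LinearEquiv.coe_coe, LinearEquiv.symm_apply_apply]
    conv_lhs => rw [← DirectSum.sum_support_of x]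
    rw [map_sum]
    refine Finset.sum_congr rfl fun g _ => ?_
    exact DirectSum.coeLinearMap_of V g (x g)

lemma IsGrading.of_proj {V : G → Submodule k M} (p : G → M →ₗ[k] M)
    (h₁ : ∀ g, ∀ m ∈ V g, p g m = m) (h₂ : ∀ g g', g ≠ g' → ∀ m ∈ V g', p g m = 0)
    (h₃ : ∀ m, m ∈ ⨆ g, V g) : IsGrading V := by
  refine ⟨fun g => ?_, eq_top_iff.2 fun m _ => h₃ m⟩
  rw [Submodule.disjoint_def]
  intro m hm hm'
  have hle : (⨆ j, ⨆ (_ : j ≠ g), V j) ≤ LinearMap.ker (p g) :=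
    iSup₂_le fun j hj x hx => h₂ g j hj.symm x hx
  rw [← h₁ g m hm]
  exact hle hm'

/-- A homogeneous `k`-linear map commutes with projections to homogeneous components. -/
lemma IsGrading.proj_comm {V : G → Submodule k M} {W : G → Submodule k N} (hV : IsGrading V)
    (f : M →ₗ[k] N) (hf : ∀ g, ∀ m ∈ V g, f m ∈ W g)
    {p : G → M →ₗ[k] M} {q : G → N →ₗ[k] N}
    (hp₁ : ∀ g, ∀ m ∈ V g, p g m = m) (hp₂ : ∀ g g', g ≠ g' → ∀ m ∈ V g', p g m = 0)
    (hq₁ : ∀ g, ∀ m ∈ W g, q g m = m) (hq₂ : ∀ g g', g ≠ g' → ∀ m ∈ W g', q g m = 0)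
    (g : G) (m : M) : f (p g m) = q g (f m) := by
  suffices h : (⨆ g, V g) ≤ LinearMap.eqLocus (f ∘ₗ p g) (q g ∘ₗ f) by
    have hm : m ∈ ⨆ g, V g := by rw [hV.iSup_eq_top]; trivial
    exact h hm
  refine iSup_le fun g' x hx => ?_
  simp only [LinearMap.mem_eqLocus, LinearMap.comp_apply]
  by_cases h : g = g'
  · subst h
    rw [hp₁ g x hx, hq₁ g _ (hf g x hx)]
  · rw [hp₂ g g' h x hx, hq₂ g g' h _ (hf g' x hx), map_zero]

lemma IsGrading.ker {V : G → Submodule k M} {W : G → Submodule k N} (hV : IsGrading V)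
    (hW : IsGrading W) (f : M →ₗ[k] N) (hf : ∀ g, ∀ m ∈ V g, f m ∈ W g) :
    IsGrading (fun g => (V g).comap (LinearMap.ker f).subtype) := by
  obtain ⟨p, hp₀, hp₁, hp₂, hp₃⟩ := hV.exists_proj
  obtain ⟨q, hq₀, hq₁, hq₂, hq₃⟩ := hW.exists_proj
  have hpf := hV.proj_comm f hf hp₁ hp₂ hq₁ hq₂
  have hpk : ∀ g, ∀ m ∈ LinearMap.ker f, p g m ∈ LinearMap.ker f := by
    intro g m hm
    rw [LinearMap.mem_ker] at hm ⊢
    rw [hpf, hm, map_zero]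
  refine IsGrading.of_proj (fun g => (p g).restrict (hpk g)) ?_ ?_ ?_
  · rintro g ⟨m, hm⟩ hm'
    exact Subtype.ext (hp₁ g m hm')
  · rintro g g' hgg ⟨m, hm⟩ hm'
    exact Subtype.ext (hp₂ g g' hgg m hm')
  · rintro ⟨m, hm⟩
    obtain ⟨s, hs⟩ := hp₃ m
    have : (⟨m, hm⟩ : LinearMap.ker f) = ∑ g ∈ s, ⟨p g m, hpk g m hm⟩ := by
      apply Subtype.ext
      simpa using hs
    rw [this]
    exact Submodule.sum_mem _ fun g _ => Submodule.mem_iSup_of_mem g (hp₀ g m)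

lemma IsGrading.map_surjective {V : G → Submodule k M} {W : G → Submodule k N}
    (hV : IsGrading V) (hW : IsGrading W) (f : M →ₗ[k] N) (hf : ∀ g, ∀ m ∈ V g, f m ∈ W g)
    {Q : Type u} [AddCommGroup Q] [Module k Q] (π : N →ₗ[k] Q) (hπ : Function.Surjective π)
    (hπf : LinearMap.ker π = LinearMap.range f) :
    IsGrading (fun g => (W g).map π) := by
  obtain ⟨p, hp₀, hp₁, hp₂, hp₃⟩ := hV.exists_proj
  obtain ⟨q, hq₀, hq₁, hq₂, hq₃⟩ := hW.exists_proj
  have hpf := hV.proj_comm f hf hp₁ hp₂ hq₁ hq₂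
  have hle : ∀ g, LinearMap.ker π ≤ LinearMap.ker (π ∘ₗ q g) := by
    intro g
    rw [hπf]
    rintro _ ⟨m, rfl⟩
    rw [LinearMap.mem_ker, LinearMap.comp_apply, ← hpf, ← LinearMap.mem_ker, hπf]
    exact ⟨_, rfl⟩
  have hdesc : ∀ g n, ((LinearMap.ker π).liftQ (π ∘ₗ q g) (hle g) ∘ₗ
      (π.quotKerEquivOfSurjective hπ).symm.toLinearMap) (π n) = π (q g n) := by
    intro g n
    have : (π.quotKerEquivOfSurjective hπ).symm (π n) = (LinearMap.ker π).mkQ n := by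
      rw [LinearEquiv.symm_apply_eq]
      rfl
    simp [this]
  refine IsGrading.of_proj (fun g => (LinearMap.ker π).liftQ (π ∘ₗ q g) (hle g) ∘ₗ
      (π.quotKerEquivOfSurjective hπ).symm.toLinearMap) ?_ ?_ ?_
  · rintro g _ ⟨n, hn, rfl⟩
    rw [hdesc, hq₁ g n hn]
  · rintro g g' hgg _ ⟨n, hn, rfl⟩
    rw [hdesc, hq₂ g g' hgg n hn, map_zero]
  · intro x
    rw [← Submodule.map_iSup, hW.iSup_eq_top, Submodule.map_top, LinearMap.range_eq_top.2 hπ]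
    trivial

lemma IsGrading.prod {V : G → Submodule k M} {W : G → Submodule k N} (hV : IsGrading V)
    (hW : IsGrading W) : IsGrading (fun g => (V g).prod (W g)) := by
  obtain ⟨p, hp₀, hp₁, hp₂, hp₃⟩ := hV.exists_proj
  obtain ⟨q, hq₀, hq₁, hq₂, hq₃⟩ := hW.exists_proj
  refine IsGrading.of_proj (fun g => (p g).prodMap (q g)) ?_ ?_ ?_
  · rintro g ⟨m, n⟩ ⟨hm, hn⟩
    exact Prod.ext (hp₁ g m hm) (hq₁ g n hn)
  · rintro g g' h ⟨m, n⟩ ⟨hm, hn⟩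
    exact Prod.ext (hp₂ g g' h m hm) (hq₂ g g' h n hn)
  · rintro ⟨m, n⟩
    obtain ⟨s, hs⟩ := hp₃ m
    obtain ⟨t, ht⟩ := hq₃ n
    have : (m, n) = ∑ g ∈ s, (p g m, (0 : N)) + ∑ g ∈ t, ((0 : M), q g n) := by
      refine Prod.ext ?_ ?_
      · simpa [Prod.fst_sum] using hs
      · simpa [Prod.snd_sum] using ht
    rw [this]
    refine Submodule.add_mem _ (Submodule.sum_mem _ fun g _ => ?_)
      (Submodule.sum_mem _ fun g _ => ?_)
    · exact Submodule.mem_iSup_of_mem g ⟨hp₀ g m, Submodule.zero_mem _⟩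
    · exact Submodule.mem_iSup_of_mem g ⟨Submodule.zero_mem _, hq₀ g n⟩

/-- The grading by `H` induced by a grading by `G` along `φ : G → H`: the component of degree `h`
is the direct sum of the components of degree `g` with `φ g = h`. -/
def pushGrading {H : Type u} (φ : G → H) (V : G → Submodule k M) (h : H) : Submodule k M :=
  ⨆ g, ⨆ (_ : φ g = h), V g

lemma IsGrading.push {V : G → Submodule k M} (hV : IsGrading V) {H : Type u} (φ : G → H) :
    IsGrading (pushGrading φ V) := by
  constructor
  · intro h
    have hle : (⨆ j, ⨆ (_ : j ≠ h), pushGrading φ V j) ≤ ⨆ g, ⨆ (_ : φ g ≠ h), V g := by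
      refine iSup₂_le fun j hj => iSup₂_le fun g hg => ?_
      exact le_iSup₂_of_le g (by rw [hg]; exact hj) le_rfl
    refine Disjoint.mono_right hle ?_
    exact hV.indep.disjoint_biSup_biSup (s := {g | φ g = h}) (t := {g | φ g ≠ h})
      (Set.disjoint_left.2 fun g hg hg' => hg' hg)
  · rw [eq_top_iff, ← hV.iSup_eq_top]
    exact iSup_le fun g => le_iSup_of_le (φ g) (le_iSup₂_of_le g rfl le_rfl)

end Linear

/-! The groups `G` and `H` are written additively; they need not be commutative here. -/

variable {k G H A : Type u} [Field k] [AddGroup G] [AddGroup H] [Ring A] [Algebra k A]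

/-- If `A` is `G`-graded then `φ_!(A)`, i.e. `A` with the components `⨁_{φ g = h} A_g`, is an
`H`-graded algebra (its components decompose `A` by `IsGrading.push`). -/
lemma gradedMonoid_push (𝒜 : G → Submodule k A) [SetLike.GradedMonoid 𝒜] (φ : G →+ H) :
    SetLike.GradedMonoid (pushGrading φ 𝒜) where
  one_mem := (le_iSup₂_of_le (f := fun (x : G) (_ : φ x = 0) => 𝒜 x) 0 (map_zero φ) le_rfl)
    SetLike.GradedOne.one_mem
  mul_mem := by
    intro h h' a b ha hb
    have hle : pushGrading φ 𝒜 h ≤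
        (pushGrading φ 𝒜 (h + h')).comap (LinearMap.mulRight k b) := by
      refine iSup₂_le fun g hg a ha => ?_
      have hle' : pushGrading φ 𝒜 h' ≤
          (pushGrading φ 𝒜 (h + h')).comap (LinearMap.mulLeft k a) := by
        refine iSup₂_le fun g' hg' b hb => ?_
        exact (le_iSup₂_of_le (f := fun (x : G) (_ : φ x = h + h') => 𝒜 x) (g + g')
          (by rw [map_add, hg, hg']) le_rfl) (SetLike.GradedMul.mul_mem ha hb)
      exact hle' hb
    exact hle ha

/-- A `G`-graded (left) module over the `k`-algebra `A` with homogeneous components `𝒜 g`: an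
`A`-module `M`, with the compatible `k`-module structure, together with a decomposition
`M = ⨁ g, M_g` into `k`-submodules such that `𝒜 g • M_{g'} ⊆ M_{g + g'}`. -/
structure GrMod (𝒜 : G → Submodule k A) where
  /-- the underlying module -/
  carrier : Type u
  [addCommGroup : AddCommGroup carrier]
  [moduleBase : Module k carrier]
  [module : Module A carrier]
  [isScalarTower : IsScalarTower k A carrier]
  /-- the homogeneous components -/
  comp : G → Submodule k carrier
  isGrading : IsGrading comp
  smul_mem : ∀ {g g' : G} {a : A} {m : carrier}, a ∈ 𝒜 g → m ∈ comp g' → a • m ∈ comp (g + g')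

attribute [instance] GrMod.addCommGroup GrMod.moduleBase GrMod.module GrMod.isScalarTower

namespace GrMod

variable {𝒜 : G → Submodule k A}

/-- Morphisms of graded modules: homogeneous `A`-linear maps. -/
@[ext]
structure Hom (M N : GrMod 𝒜) where
  /-- the underlying `A`-linear map -/
  hom : M.carrier →ₗ[A] N.carrier
  map_mem : ∀ g, ∀ m ∈ M.comp g, hom m ∈ N.comp g

/-- The category of `G`-graded `A`-modules. -/
instance : Category.{u} (GrMod 𝒜) where
  Hom M N := Hom M N
  id M := ⟨LinearMap.id, fun _ _ h => h⟩
  comp f f' := ⟨f'.hom ∘ₗ f.hom, fun g m h => f'.map_mem g _ (f.map_mem g m h)⟩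

/-- The underlying linear map of a morphism. -/
abbrev lin {M N : GrMod 𝒜} (f : M ⟶ N) : M.carrier →ₗ[A] N.carrier := Hom.hom f

/-- A morphism from a homogeneous linear map. -/
abbrev ofLin {M N : GrMod 𝒜} (f : M.carrier →ₗ[A] N.carrier)
    (hf : ∀ g, ∀ m ∈ M.comp g, f m ∈ N.comp g) : M ⟶ N := Hom.mk f hf

lemma lin_injective {M N : GrMod 𝒜} : Function.Injective (lin : (M ⟶ N) → _) :=
  fun _ _ h => Hom.ext h

lemma hom_ext {M N : GrMod 𝒜} {f f' : M ⟶ N} (h : ∀ m, lin f m = lin f' m) : f = f' :=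
  lin_injective (LinearMap.ext h)

@[simp] lemma lin_comp {M N P : GrMod 𝒜} (f : M ⟶ N) (f' : N ⟶ P) (m : M.carrier) :
    lin (f ≫ f') m = lin f' (lin f m) := rfl

@[simp] lemma lin_id {M : GrMod 𝒜} (m : M.carrier) : lin (𝟙 M) m = m := rfl

section

variable {M N : GrMod 𝒜}

instance : Zero (M ⟶ N) := ⟨ofLin 0 fun _ _ _ => Submodule.zero_mem _⟩

instance : Add (M ⟶ N) := ⟨fun f f' => ofLin (lin f + lin f') fun g m h =>
  Submodule.add_mem _ (f.map_mem g m h) (f'.map_mem g m h)⟩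

instance : Neg (M ⟶ N) := ⟨fun f => ofLin (-lin f) fun g m h =>
  Submodule.neg_mem _ (f.map_mem g m h)⟩

instance : Sub (M ⟶ N) := ⟨fun f f' => ofLin (lin f - lin f') fun g m h =>
  Submodule.sub_mem _ (f.map_mem g m h) (f'.map_mem g m h)⟩

instance : SMul ℕ (M ⟶ N) := ⟨fun n f => ofLin (n • lin f) fun g m h =>
  nsmul_mem (f.map_mem g m h) n⟩

instance : SMul ℤ (M ⟶ N) := ⟨fun n f => ofLin (n • lin f) fun g m h =>
  zsmul_mem (f.map_mem g m h) n⟩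

instance : AddCommGroup (M ⟶ N) :=
  Function.Injective.addCommGroup lin lin_injective rfl (fun _ _ => rfl) (fun _ => rfl)
    (fun _ _ => rfl) (fun _ _ => rfl) (fun _ _ => rfl)

@[simp] lemma lin_zero (m : M.carrier) : lin (0 : M ⟶ N) m = 0 := rfl

@[simp] lemma lin_add (f f' : M ⟶ N) (m : M.carrier) : lin (f + f') m = lin f m + lin f' m := rfl

end

instance : Preadditive (GrMod 𝒜) where
  add_comp _ _ _ f f' h := hom_ext fun m => map_add (lin h) _ _
  comp_add _ _ _ f h h' := hom_ext fun _ => rfl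

/-- The kernel of a morphism, with the grading induced from the source. -/
def kerObj {M N : GrMod 𝒜} (f : M ⟶ N) : GrMod 𝒜 where
  carrier := LinearMap.ker (lin f)
  comp g := (M.comp g).comap ((LinearMap.ker (lin f)).subtype.restrictScalars k)
  isGrading := IsGrading.ker M.isGrading N.isGrading ((lin f).restrictScalars k) f.map_mem
  smul_mem ha hm := M.smul_mem ha hm

/-- The inclusion of the kernel. -/
def kerι {M N : GrMod 𝒜} (f : M ⟶ N) : kerObj f ⟶ M :=
  ofLin (LinearMap.ker (lin f)).subtype fun _ _ h => h

lemma isGrading_coker {M N : GrMod 𝒜} (f : M ⟶ N) : IsGrading (fun g =>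
    (N.comp g).map ((LinearMap.range (lin f)).mkQ.restrictScalars k)) := by
  refine IsGrading.map_surjective (V := M.comp) M.isGrading N.isGrading
    ((lin f).restrictScalars k) f.map_mem
    ((LinearMap.range (lin f)).mkQ.restrictScalars k) ?_ ?_
  · exact Submodule.mkQ_surjective (LinearMap.range (lin f))
  · ext x
    exact Submodule.Quotient.mk_eq_zero (LinearMap.range (lin f))

/-- The cokernel of a morphism, with the grading induced from the target. -/
def cokerObj {M N : GrMod 𝒜} (f : M ⟶ N) : GrMod 𝒜 where
  carrier := N.carrier ⧸ LinearMap.range (lin f)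
  comp g := (N.comp g).map ((LinearMap.range (lin f)).mkQ.restrictScalars k)
  isGrading := isGrading_coker f
  smul_mem := by
    rintro g g' a _ ha ⟨n, hn, rfl⟩
    exact ⟨a • n, N.smul_mem ha hn, map_smul (LinearMap.range (lin f)).mkQ a n⟩

/-- The projection to the cokernel. -/
def cokerπ {M N : GrMod 𝒜} (f : M ⟶ N) : N ⟶ cokerObj f :=
  ofLin (LinearMap.range (lin f)).mkQ fun _ m h => ⟨m, h, rfl⟩

/-- An injective homogeneous map reflects homogeneous elements. -/
lemma mem_comp_of_injective {M N : GrMod 𝒜} (f : M ⟶ N) (hf : Function.Injective (lin f))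
    {g : G} {m : M.carrier} (hm : lin f m ∈ N.comp g) : m ∈ M.comp g := by
  obtain ⟨p, hp₀, hp₁, hp₂, -⟩ := M.isGrading.exists_proj
  obtain ⟨q, -, hq₁, hq₂, -⟩ := N.isGrading.exists_proj
  have := M.isGrading.proj_comm ((lin f).restrictScalars k) f.map_mem hp₁ hp₂ hq₁ hq₂ g m
  have h : m = p g m := hf (by
    refine Eq.trans ?_ this.symm
    exact (hq₁ g _ hm).symm)
  rw [h]
  exact hp₀ g m

/-- A surjective homogeneous map is surjective on homogeneous components. -/
lemma exists_mem_comp_of_surjective {M N : GrMod 𝒜} (f : M ⟶ N)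
    (hf : Function.Surjective (lin f)) {g : G} {n : N.carrier} (hn : n ∈ N.comp g) :
    ∃ m ∈ M.comp g, lin f m = n := by
  obtain ⟨p, hp₀, hp₁, hp₂, -⟩ := M.isGrading.exists_proj
  obtain ⟨q, -, hq₁, hq₂, -⟩ := N.isGrading.exists_proj
  obtain ⟨m, rfl⟩ := hf n
  have := M.isGrading.proj_comm ((lin f).restrictScalars k) f.map_mem hp₁ hp₂ hq₁ hq₂ g m
  exact ⟨p g m, hp₀ g m, this.trans (hq₁ g _ hn)⟩

lemma apply_ofInjective_symm {M N : GrMod 𝒜} (f : M ⟶ N) (hf : Function.Injective (lin f))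
    (x : LinearMap.range (lin f)) :
    lin f ((LinearEquiv.ofInjective (lin f) hf).symm x) = x := by
  rw [← LinearEquiv.ofInjective_apply (h := hf), LinearEquiv.apply_symm_apply]

lemma comp_eq_zero_apply {M N P : GrMod 𝒜} {f : M ⟶ N} {f' : N ⟶ P} (w : f ≫ f' = 0)
    (m : M.carrier) : lin f' (lin f m) = 0 := by
  rw [← lin_comp, w, lin_zero]

/-- Factorization of a map through an injective homogeneous map. -/
noncomputable def liftOfInjective {M N Z : GrMod 𝒜} (f : M ⟶ N) (hf : Function.Injective (lin f))
    (s : Z ⟶ N) (hs : ∀ z, lin s z ∈ LinearMap.range (lin f)) : Z ⟶ M :=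
  ofLin ((LinearEquiv.ofInjective (lin f) hf).symm.toLinearMap ∘ₗ
      (lin s).codRestrict (LinearMap.range (lin f)) hs) (fun g z hz => by
    refine mem_comp_of_injective f hf ?_
    have h := apply_ofInjective_symm f hf ⟨lin s z, hs z⟩
    exact (congrArg (· ∈ N.comp g) h).mpr (s.map_mem g z hz))

lemma liftOfInjective_comp {M N Z : GrMod 𝒜} (f : M ⟶ N) (hf : Function.Injective (lin f))
    (s : Z ⟶ N) (hs : ∀ z, lin s z ∈ LinearMap.range (lin f)) :
    liftOfInjective f hf s hs ≫ f = s :=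
  hom_ext fun z => apply_ofInjective_symm f hf ⟨lin s z, hs z⟩

/-- An injective morphism is a kernel of any morphism whose kernel is its range. -/
noncomputable def isLimitOfInjective {M N P : GrMod 𝒜} (f : M ⟶ N) (f' : N ⟶ P)
    (hf : Function.Injective (lin f)) (hff : LinearMap.range (lin f) = LinearMap.ker (lin f'))
    (w : f ≫ f' = 0) : IsLimit (KernelFork.ofι f w) :=
  KernelFork.IsLimit.ofι f w
    (fun s hs => liftOfInjective f hf s fun z => by
      rw [hff, LinearMap.mem_ker]
      exact comp_eq_zero_apply hs z)
    (fun s _ => liftOfInjective_comp f hf s _)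
    (fun s hs t ht => hom_ext fun z => hf (by
      have h := liftOfInjective_comp f hf s (fun z => by
        rw [hff, LinearMap.mem_ker]
        exact comp_eq_zero_apply hs z)
      rw [← lin_comp, ← lin_comp, ht, h]))

/-- A surjective morphism is a cokernel of any morphism whose range is its kernel. -/
noncomputable def isColimitOfSurjective {M N P : GrMod 𝒜} (f : M ⟶ N) (f' : N ⟶ P)
    (hf : Function.Surjective (lin f')) (hff : LinearMap.range (lin f) = LinearMap.ker (lin f'))
    (w : f ≫ f' = 0) : IsColimit (CokernelCofork.ofπ f' w) :=
  have hle : ∀ {Z : GrMod 𝒜} (s : N ⟶ Z), f ≫ s = 0 →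
      LinearMap.ker (lin f') ≤ LinearMap.ker (lin s) := fun {Z} s hs => by
    rw [← hff]
    rintro _ ⟨m, rfl⟩
    rw [LinearMap.mem_ker, ← lin_comp, hs, lin_zero]
  have h : ∀ {Z : GrMod 𝒜} (s : N ⟶ Z) (hs : f ≫ s = 0) (n : N.carrier),
      ((LinearMap.ker (lin f')).liftQ (lin s) (hle s hs) ∘ₗ
        ((lin f').quotKerEquivOfSurjective hf).symm.toLinearMap) (lin f' n) = lin s n := by
    intro Z s hs n
    have : ((lin f').quotKerEquivOfSurjective hf).symm (lin f' n) =
        (LinearMap.ker (lin f')).mkQ n := by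
      rw [LinearEquiv.symm_apply_eq]
      rfl
    simp [this]
  CokernelCofork.IsColimit.ofπ f' w
    (fun {Z} s hs => ofLin
      ((LinearMap.ker (lin f')).liftQ (lin s) (hle s hs) ∘ₗ
        ((lin f').quotKerEquivOfSurjective hf).symm.toLinearMap)
      (fun g x hx => by
        obtain ⟨n, hn, rfl⟩ := exists_mem_comp_of_surjective f' hf hx
        rw [h s hs]
        exact s.map_mem g n hn))
    (fun {Z} s hs => hom_ext fun n => h s hs n)
    (fun {Z} s hs t ht => hom_ext fun x => by
      obtain ⟨n, rfl⟩ := hf x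
      refine Eq.trans ?_ (h s hs n).symm
      rw [← lin_comp, ht])

lemma kerι_comp {M N : GrMod 𝒜} (f : M ⟶ N) : kerι f ≫ f = 0 :=
  hom_ext fun m => LinearMap.mem_ker.1 (Subtype.property (p := (· ∈ LinearMap.ker (lin f))) m)

lemma comp_cokerπ {M N : GrMod 𝒜} (f : M ⟶ N) : f ≫ cokerπ f = 0 :=
  hom_ext fun m => (Submodule.Quotient.mk_eq_zero (LinearMap.range (lin f))).2 ⟨m, rfl⟩

lemma range_kerι {M N : GrMod 𝒜} (f : M ⟶ N) :
    LinearMap.range (lin (kerι f)) = LinearMap.ker (lin f) := Submodule.range_subtype _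

lemma ker_cokerπ {M N : GrMod 𝒜} (f : M ⟶ N) :
    LinearMap.range (lin f) = LinearMap.ker (lin (cokerπ f)) := (Submodule.ker_mkQ _).symm

lemma injective_of_mono {M N : GrMod 𝒜} (f : M ⟶ N) [Mono f] : Function.Injective (lin f) := by
  rw [← LinearMap.ker_eq_bot, eq_bot_iff]
  intro m hm
  have h : kerι f = 0 := by
    rw [← cancel_mono f, kerι_comp, zero_comp]
  exact congrArg (fun t => lin t (⟨m, hm⟩ : LinearMap.ker (lin f))) h

lemma surjective_of_epi {M N : GrMod 𝒜} (f : M ⟶ N) [Epi f] : Function.Surjective (lin f) := by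
  intro n
  have h : cokerπ f = 0 := by
    rw [← cancel_epi f, comp_cokerπ, comp_zero]
  have h' : lin (cokerπ f) n = 0 := by rw [h, lin_zero]
  exact (Submodule.Quotient.mk_eq_zero (LinearMap.range (lin f))).1 h'

instance : HasKernels (GrMod 𝒜) where
  has_limit f := ⟨⟨⟨_, isLimitOfInjective (kerι f) f Subtype.val_injective (range_kerι f)
    (kerι_comp f)⟩⟩⟩

instance : HasCokernels (GrMod 𝒜) where
  has_colimit f := ⟨⟨⟨_, isColimitOfSurjective f (cokerπ f) (Submodule.mkQ_surjective _)
    (ker_cokerπ f) (comp_cokerπ f)⟩⟩⟩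

/-- The zero graded module. -/
def zeroObj (𝒜 : G → Submodule k A) : GrMod 𝒜 where
  carrier := PUnit
  comp _ := ⊤
  isGrading := IsGrading.of_proj (fun _ => 0) (fun _ _ _ => rfl) (fun _ _ _ _ _ => rfl)
    (fun m => (Subsingleton.elim (0 : PUnit) m) ▸ Submodule.zero_mem _)
  smul_mem _ _ := trivial

instance : HasZeroObject (GrMod 𝒜) where
  zero := ⟨zeroObj 𝒜, by
    rw [IsZero.iff_id_eq_zero]
    exact hom_ext fun _ => Subsingleton.elim (α := PUnit) _ _⟩

/-- The product of two graded modules. -/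
def prodObj (M N : GrMod 𝒜) : GrMod 𝒜 where
  carrier := M.carrier × N.carrier
  comp g := (M.comp g).prod (N.comp g)
  isGrading := M.isGrading.prod N.isGrading
  smul_mem ha hm := ⟨M.smul_mem ha hm.1, N.smul_mem ha hm.2⟩

instance : HasBinaryProducts (GrMod 𝒜) :=
  @hasBinaryProducts_of_hasLimit_pair _ _ (fun {M N} => ⟨⟨{
    cone := BinaryFan.mk (P := prodObj M N)
      (ofLin (LinearMap.fst A M.carrier N.carrier) fun _ _ h => h.1)
      (ofLin (LinearMap.snd A M.carrier N.carrier) fun _ _ h => h.2)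
    isLimit := BinaryFan.IsLimit.mk _
      (fun f f' => ofLin ((lin f).prod (lin f')) fun g m h =>
        ⟨f.map_mem g m h, f'.map_mem g m h⟩)
      (fun _ _ => rfl) (fun _ _ => rfl)
      (fun f f' t h₁ h₂ => by subst h₁ h₂; rfl) }⟩⟩)

instance : HasFiniteProducts (GrMod 𝒜) := hasFiniteProducts_of_has_binary_and_terminal

/-- The category of graded modules is abelian. -/
noncomputable instance : Abelian (GrMod 𝒜) where
  normalMonoOfMono f _ := ⟨{
    Z := cokerObj f
    g := cokerπ f
    w := comp_cokerπ f
    isLimit := isLimitOfInjective f (cokerπ f) (injective_of_mono f) (ker_cokerπ f) _ }⟩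
  normalEpiOfEpi f _ := ⟨{
    W := kerObj f
    g := kerι f
    w := kerι_comp f
    isColimit := isColimitOfSurjective (kerι f) f (surjective_of_epi f) (range_kerι f) _ }⟩

/-- `M` is `φ`-finite if `supp M ∩ φ⁻¹(h)` is finite for every `h`, where
`supp M = {g | M_g ≠ 0}`. -/
def PhiFinite (φ : G →+ H) (M : GrMod 𝒜) : Prop :=
  ∀ h : H, {g : G | M.comp g ≠ ⊥ ∧ φ g = h}.Finite

/-- The object part of `φ_!`: the underlying `A`-module is unchanged and the component of degree
`h` is `⨁_{φ g = h} M_g`. -/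
def pushObj (φ : G →+ H) (M : GrMod 𝒜) : GrMod (pushGrading φ 𝒜) where
  carrier := M.carrier
  comp := pushGrading φ M.comp
  isGrading := M.isGrading.push φ
  smul_mem := by
    intro h h' a m ha hm
    have hle : pushGrading φ 𝒜 h ≤ (pushGrading φ M.comp (h + h')).comap
        ((LinearMap.toSpanSingleton A M.carrier m).restrictScalars k) := by
      refine iSup₂_le fun g hg a ha => ?_
      have hle' : pushGrading φ M.comp h' ≤ (pushGrading φ M.comp (h + h')).comap
          (Algebra.lsmul k k M.carrier a) := by
        refine iSup₂_le fun g' hg' m hm => ?_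
        exact (le_iSup₂_of_le (f := fun (x : G) (_ : φ x = h + h') => M.comp x) (g + g')
          (by rw [map_add, hg, hg']) le_rfl) (M.smul_mem ha hm)
      exact hle' hm
    exact hle ha

lemma map_mem_push (φ : G →+ H) {M N : GrMod 𝒜} (f : M ⟶ N) (h : H) (m : M.carrier)
    (hm : m ∈ pushGrading φ M.comp h) : lin f m ∈ pushGrading φ N.comp h := by
  have hle : pushGrading φ M.comp h ≤
      (pushGrading φ N.comp h).comap ((lin f).restrictScalars k) :=
    iSup₂_le fun g hg m hm =>
      (le_iSup₂_of_le (f := fun (x : G) (_ : φ x = h) => N.comp x) g hg le_rfl)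
        (f.map_mem g m hm)
  exact hle hm

/-- The change of grading functor `φ_! : Gr_G A ⥤ Gr_H φ_!(A)`. -/
def pushforward (φ : G →+ H) (𝒜 : G → Submodule k A) : GrMod 𝒜 ⥤ GrMod (pushGrading φ 𝒜) where
  obj M := pushObj φ M
  map {M N} f := ofLin (M := pushObj φ M) (N := pushObj φ N) (lin (M := M) (N := N) f)
    (map_mem_push φ f)

instance (φ : G →+ H) (𝒜 : G → Submodule k A) : (pushforward φ 𝒜).Additive where
  map_add := rfl

end GrMod

/-- `A` is graded left noetherian: every graded `A`-submodule (a submodule spanned by its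
homogeneous elements) of a finitely generated graded `A`-module is finitely generated. -/
def IsGradedLeftNoetherian (𝒜 : G → Submodule k A) : Prop :=
  ∀ M : GrMod 𝒜, Module.Finite A M.carrier → ∀ N : Submodule A M.carrier,
    N.restrictScalars k ≤ ⨆ g, N.restrictScalars k ⊓ M.comp g → N.FG

section Complexes

variable {C : Type*} [Category* C] [Abelian C]

/-- `K` has an injective resolution (a quasi-isomorphism `K ⟶ I` to a bounded below complex of
injective objects) with `I^i = 0` for `i > n`. -/
def HasInjResolutionLE (K : CochainComplex C ℤ) (n : ℤ) : Prop :=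
  ∃ (I : CochainComplex C ℤ) (f : K ⟶ I), QuasiIso f ∧ (∀ i, Injective (I.X i)) ∧
    (∃ a : ℤ, ∀ i < a, IsZero (I.X i)) ∧ ∀ i > n, IsZero (I.X i)

/-- The injective dimension of a complex: the infimum of the `n` such that it has an injective
resolution vanishing in degrees `> n`. It is `⊥` for acyclic complexes, and `⊤` if there is no
such `n`. -/
noncomputable def injDim (K : CochainComplex C ℤ) : WithBot (WithTop ℤ) :=
  sInf {x | ∃ n : ℤ, x = ((n : WithTop ℤ) : WithBot (WithTop ℤ)) ∧ HasInjResolutionLE K n}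

end Complexes

/-- The projective dimension of the trivial module `k` over the group algebra `k[L]`. -/
noncomputable def projDimTrivial (k L : Type u) [Field k] [Group L] : WithBot ℕ∞ :=
  projectiveDimension (ModuleCat.of (MonoidAlgebra k L) (Representation.trivial k L k).asModule)

/-- The inclusion of `{-∞} ∪ ℕ ∪ {∞}` in `{-∞} ∪ ℤ ∪ {∞}`. -/
def castDim : WithBot ℕ∞ → WithBot (WithTop ℤ) :=
  WithBot.map (WithTop.map (fun n : ℕ => (n : ℤ)))

end GradedInjDim

/-!
Write `φ_!` for the change of grading along `φ`, `φ^*` for its right adjoint, `φ^*(X)_g = X_{φ g}`,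
and `φ_*` for the right adjoint of `φ^*`, `φ_*(M)_h = ∏_{φ g = h} M_g`. All three functors are
exact, so that `φ^*` and `φ_*` preserve injective objects. A bounded below complex `K` has an
injective resolution which vanishes above `n` if and only if `Ext^i(X, K) = 0` for all objects `X`
and all `i > n` (`HasInjResolutionLE.homVanishesAbove`, `HomVanishesAbove.hasInjResolutionLE`). This
condition passes to direct summands in the derived category.

The module `M` is naturally a direct summand of `φ^*φ_!(M)`, where
`φ^*φ_!(M)_g = ⨁_{l ∈ ker φ} M_{g + l}`. Applying `φ^*` to a resolution of `φ_!(R)` therefore bounds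
the injective dimension of `R` by that of `φ_!(R)` (`hasInjResolutionLE_of_push`). If the cohomology
of `R` is `φ`-finite, then the natural map `φ_!(R) → φ_*(R)` is a quasi-isomorphism, because it is
an isomorphism on `φ`-finite modules, and `φ_*` turns a resolution of `R` into a resolution of
`φ_!(R)` of the same length (`HasInjResolutionLE.push_of_phiFinite`).

For the remaining inequality, let `L = ker φ`, and let `I` be an injective `G`-graded module over a
graded left noetherian algebra. Then `φ^*φ_!(I)` is injective by a graded version of Baer's
criterion: a map from a finitely generated module to `φ_!(I)` has only finitely many components of
different degrees in `L`, and each of them can be extended (`injective_pushFamily_sum`). For a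
`k[L]`-module `V` and an `H`-graded module `X` let `twist V X` be the `H`-graded module of the
functions `f` on `G` with values `f g ∈ Hom_k(V, X_{φ g})` which satisfy
`f (g + l) v = f g (l • v)`. Up to the choice of representatives of the cosets of `L` this is
`Hom_k(V, X_h)` in the degrees `h` in the image of `φ`, so `twist` is exact in `V`, and
`twist k (φ_!(M)) = φ_!(M)`. Moreover
`Hom(N, twist V X) = Hom_{k[L]}(V, Hom(N, φ_*φ^*(X)))`, so that `twist V X` is injective if `V` is
projective and `φ^*(X)` is injective (`injective_twistObj`). Dimension shifting along a projective
resolution of the trivial module shows that the injective dimension of `φ_!(I)` is at most the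
projective dimension of `k`, and likewise for bounded complexes of injective modules
(`homVanishesAbove_twist`).
-/

/-! ### Injective dimension and the derived category -/

namespace GradedInjDim

section Homological

open DerivedCategory Pretriangulated ZeroObject

universe w v u'

variable {C : Type u'} [Category.{v} C] [Abelian C]

/-- All morphisms in the derived category to the complex `K` from an object of `C` placed in a
degree `> n` vanish; in other words `Ext^i(X, K) = 0` for all `X` and all `i > n`. -/
def HomVanishesAbove [HasDerivedCategory.{w} C] (K : CochainComplex C ℤ) (n : ℤ) : Prop :=
  ∀ (X : C) (i : ℤ), n < i →
    ∀ f : Q.obj ((HomologicalComplex.single C (ComplexShape.up ℤ) i).obj X) ⟶ Q.obj K, f = 0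

lemma isKInjective_of_bounded {K : CochainComplex C ℤ} {a : ℤ} (hK : ∀ i, Injective (K.X i))
    (ha : ∀ i < a, IsZero (K.X i)) : K.IsKInjective := by
  have : K.IsStrictlyGE a := (K.isStrictlyGE_iff a).2 ha
  exact CochainComplex.isKInjective_of_injective K a

section

variable [HasDerivedCategory.{w} C] {K K' : CochainComplex C ℤ} {n : ℤ}

lemma HomVanishesAbove.of_retract (h : HomVanishesAbove K' n)
    (i : Q.obj K ⟶ Q.obj K') (r : Q.obj K' ⟶ Q.obj K) (hir : i ≫ r = 𝟙 _) :
    HomVanishesAbove K n := fun X j hj f => by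
  rw [← Category.comp_id f, ← hir, ← Category.assoc, h X j hj (f ≫ i), zero_comp]

lemma homVanishesAbove_iff_of_quasiIso (f : K ⟶ K') [QuasiIso f] :
    HomVanishesAbove K n ↔ HomVanishesAbove K' n :=
  ⟨fun h => h.of_retract (inv (Q.map f)) (Q.map f) (by simp),
    fun h => h.of_retract (Q.map f) (inv (Q.map f)) (by simp)⟩

lemma HomVanishesAbove.of_le {m : ℤ} (h : HomVanishesAbove K n) (hnm : n ≤ m) :
    HomVanishesAbove K m := fun X i hi f => h X i (hnm.trans_lt hi) f

/-- Every morphism in the derived category to a K-injective complex is represented by a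
morphism of complexes. -/
lemma exists_Q_map_eq (L : CochainComplex C ℤ) [L.IsKInjective] (f : Q.obj K ⟶ Q.obj L) :
    ∃ g : K ⟶ L, Q.map g = f := by
  obtain ⟨g, hg⟩ := (CochainComplex.IsKInjective.Qh_map_bijective _ _).surjective
    ((quotientCompQhIso C).hom.app K ≫ f ≫ (quotientCompQhIso C).inv.app L)
  obtain ⟨g, rfl⟩ := (HomotopyCategory.quotient _ _).map_surjective g
  refine ⟨g, ?_⟩
  rw [← cancel_epi ((quotientCompQhIso C).hom.app K), ← quotientCompQhIso_hom_naturality, hg]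
  simp

lemma nonempty_homotopy_of_Q_map_eq {L : CochainComplex C ℤ} [L.IsKInjective] {f g : K ⟶ L}
    (h : Q.map f = Q.map g) : Nonempty (Homotopy f g) := by
  refine ⟨HomotopyCategory.homotopyOfEq _ _
    ((CochainComplex.IsKInjective.Qh_map_bijective _ _).injective ?_)⟩
  rw [← cancel_mono ((quotientCompQhIso C).hom.app L), quotientCompQhIso_hom_naturality,
    quotientCompQhIso_hom_naturality, h]

lemma homVanishesAbove_of_isKInjective [K.IsKInjective] (h : ∀ i > n, IsZero (K.X i)) :
    HomVanishesAbove K n := fun X i hi f => by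
  obtain ⟨g, rfl⟩ := exists_Q_map_eq K f
  have : g = 0 := HomologicalComplex.from_single_hom_ext ((h i hi).eq_of_tgt _ _)
  rw [this, Functor.map_zero]

lemma HasInjResolutionLE.homVanishesAbove (h : HasInjResolutionLE K n) :
    HomVanishesAbove K n := by
  obtain ⟨I, f, hf, hI, ⟨a, ha⟩, hn⟩ := h
  have := isKInjective_of_bounded hI ha
  exact (homVanishesAbove_iff_of_quasiIso f).2 (homVanishesAbove_of_isKInjective hn)

/-- If `I` is a bounded below complex of injectives to which no maps exist from objects in degree
`> n`, then `I` splits off its cycles in all degrees `> n`. -/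
lemma HomVanishesAbove.exists_section [K.IsKInjective] (h : HomVanishesAbove K n) (i j : ℤ)
    (hij : i + 1 = j) (hj : n < j) : ∃ s : K.cycles j ⟶ K.X i, s ≫ K.toCycles i j = 𝟙 _ := by
  let g : (HomologicalComplex.single C (ComplexShape.up ℤ) j).obj (K.cycles j) ⟶ K :=
    HomologicalComplex.mkHomFromSingle (K.iCycles j) (fun k _ => by simp)
  obtain ⟨H⟩ := nonempty_homotopy_of_Q_map_eq (f := g) (g := 0)
    (by rw [h _ j hj (Q.map g), Functor.map_zero])
  refine ⟨(HomologicalComplex.singleObjXSelf (ComplexShape.up ℤ) j (K.cycles j)).inv ≫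
    H.hom j i, ?_⟩
  have h1 := H.comm j
  rw [HomologicalComplex.zero_f, add_zero, HomologicalComplex.mkHomFromSingle_f,
    prevD_eq H.hom (j' := i) (by simpa using hij),
    dNext_eq H.hom (i' := j + 1) (by simp)] at h1
  simp only [HomologicalComplex.single_obj_d, zero_comp, zero_add] at h1
  rw [← cancel_mono (K.iCycles j)]
  simp [← h1]

/-- The converse of `HasInjResolutionLE.homVanishesAbove`. By `HomVanishesAbove.exists_section` any
bounded below injective resolution is exact above degree `n`, and its cycles of degree `n` are
injective, being a direct summand. So it can be truncated in degree `n`. -/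
lemma HomVanishesAbove.hasInjResolutionLE [EnoughInjectives C] (h : HomVanishesAbove K n)
    {a : ℤ} (ha : ∀ i < a, IsZero (K.X i)) : HasInjResolutionLE K n := by
  have : K.IsStrictlyGE a := (K.isStrictlyGE_iff a).2 ha
  obtain ⟨I, f, hf, hI, hIa⟩ :=
    CochainComplex.Plus.modelCategoryQuillen.exists_quasiIso_injective K a
  have : I.IsKInjective := CochainComplex.isKInjective_of_injective I a
  rw [homVanishesAbove_iff_of_quasiIso f] at h
  have hLE : I.IsLE n := by
    rw [CochainComplex.isLE_iff]
    intro j hj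
    obtain ⟨s, hs⟩ := h.exists_section (j - 1) j (by lia) hj
    have : Epi (I.toCycles (j - 1) j) := epi_of_epi_fac hs
    rw [HomologicalComplex.exactAt_iff_isZero_homology]
    have h0 : I.homologyπ j = 0 := by
      rw [← cancel_epi (I.toCycles (j - 1) j)]
      simp
    rw [IsZero.iff_id_eq_zero, ← cancel_epi (I.homologyπ j), h0, zero_comp, zero_comp]
  have hcyc : Injective (I.cycles n) := by
    obtain ⟨s, hs⟩ := h.exists_section n (n + 1) rfl (by lia)
    let S : ShortComplex C := ShortComplex.mk (I.iCycles n) (I.toCycles n (n + 1)) (by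
      rw [← cancel_mono (I.iCycles (n + 1))]; simp)
    have : Epi S.g := epi_of_epi_fac hs
    have hS : S.Exact := by
      refine S.exact_of_f_is_kernel ?_
      refine KernelFork.IsLimit.ofι _ _
        (fun t ht => I.liftCycles t (n + 1) (by simp) (?_ : t ≫ I.d n (n + 1) = 0))
        (fun t ht => by simp [S]) (fun t ht m hm => ?_)
      · have := congrArg (· ≫ I.iCycles (n + 1)) ht
        simpa [S] using this
      · rw [← cancel_mono (I.iCycles n)]
        simpa using hm
    exact Retract.injective
      { i := _, r := _, retract := (ShortComplex.Splitting.ofExactOfSection S hS s hs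
          (by dsimp [S]; infer_instance)).f_r }
  have hT : ∀ i, Injective ((I.truncLE n).X i) := fun i => by
    obtain hi | rfl | hi := lt_trichotomy i n
    · exact Injective.of_iso (I.truncLEXIso n i hi).symm (hI i)
    · exact Injective.of_iso (I.truncLEXIsoCycles i).symm hcyc
    · exact (CochainComplex.isZero_of_isStrictlyLE _ n _ hi).injective
  have hTa : ∀ i < min a n, IsZero ((I.truncLE n).X i) := fun i hi =>
    (I.isZero_of_isStrictlyGE a i (by lia)).of_iso (I.truncLEXIso n i (by lia))
  have := isKInjective_of_bounded hT hTa
  -- the truncation maps to `I`, and the zigzag `K ⟶ I ⟵ truncLE` is represented by one morphism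
  -- since the truncation is K-injective
  obtain ⟨g, hg⟩ := exists_Q_map_eq (I.truncLE n) (Q.map f ≫ inv (Q.map (I.ιTruncLE n)))
  refine ⟨I.truncLE n, g, ?_, hT, ⟨_, hTa⟩,
    fun i hi => CochainComplex.isZero_of_isStrictlyLE _ n _ hi⟩
  rw [← isIso_Q_map_iff_quasiIso, hg]
  infer_instance

/-- Dimension shifting along a distinguished triangle. -/
lemma eq_zero_of_distTriang {D : Type*} [Category* D] [Preadditive D] [HasZeroObject D]
    [HasShift D ℤ] [∀ n : ℤ, (shiftFunctor D n).Additive] [Pretriangulated D]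
    {X₁ X₂ X₃ : D} {u : X₁ ⟶ X₂} {v : X₂ ⟶ X₃} {w : X₃ ⟶ X₁⟦(1 : ℤ)⟧}
    (hT : Triangle.mk u v w ∈ distTriang D) {X : D} (f : X ⟶ X₁) (h₂ : f ≫ u = 0)
    (h₃ : ∀ g : X⟦(1 : ℤ)⟧ ⟶ X₃, g = 0) : f = 0 := by
  obtain ⟨g, hg⟩ : ∃ g : X⟦(1 : ℤ)⟧ ⟶ X₃, f⟦(1 : ℤ)⟧' = g ≫ w :=
      Triangle.coyoneda_exact₁ _ hT (f⟦(1 : ℤ)⟧') (by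
    change f⟦(1 : ℤ)⟧' ≫ u⟦(1 : ℤ)⟧' = 0
    rw [← Functor.map_comp, h₂, Functor.map_zero])
  apply (shiftFunctor D (1 : ℤ)).map_injective
  rw [hg, h₃ g, zero_comp, Functor.map_zero]

/-- Dimension shifting along a short exact sequence of complexes. -/
lemma HomVanishesAbove.of_shortExact {S : ShortComplex (CochainComplex C ℤ)}
    (hS : S.ShortExact) (h₂ : HomVanishesAbove S.X₂ (n + 1)) (h₃ : HomVanishesAbove S.X₃ n) :
    HomVanishesAbove S.X₁ (n + 1) := fun X i hi f => by
  refine eq_zero_of_distTriang (triangleOfSES_distinguished hS) f (h₂ X i hi _) fun g => ?_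
  let e : (Q.obj ((HomologicalComplex.single C (ComplexShape.up ℤ) i).obj X))⟦(1 : ℤ)⟧ ≅
      Q.obj ((HomologicalComplex.single C (ComplexShape.up ℤ) (i - 1)).obj X) :=
    ((singleFunctors C).shiftIso 1 (i - 1) i (by lia)).app X
  rw [← cancel_epi e.inv, comp_zero]
  exact h₃ X (i - 1) (by lia) _

end

lemma injDim_eq_of_forall_iff {D : Type*} [Category* D] [Abelian D] {K : CochainComplex C ℤ}
    {K' : CochainComplex D ℤ}
    (h : ∀ n, HasInjResolutionLE K n ↔ HasInjResolutionLE K' n) : injDim K = injDim K' := by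
  simp only [injDim, h]

lemma injDim_le_of_forall_imp {D : Type*} [Category* D] [Abelian D] {K : CochainComplex C ℤ}
    {K' : CochainComplex D ℤ}
    (h : ∀ n, HasInjResolutionLE K n → HasInjResolutionLE K' n) : injDim K' ≤ injDim K :=
  sInf_le_sInf fun _ ⟨n, hn, hK⟩ => ⟨n, hn, h n hK⟩

lemma injDim_le_coe {K : CochainComplex C ℤ} {n : ℤ} (h : HasInjResolutionLE K n) :
    injDim K ≤ ((n : WithTop ℤ) : WithBot (WithTop ℤ)) :=
  sInf_le ⟨n, rfl, h⟩

/-- Either there is no resolution at all, or there are resolutions in arbitrarily small degrees, or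
the infimum in the definition of `injDim` is attained. -/
lemma injDim_cases (K : CochainComplex C ℤ) :
    injDim K = ⊤ ∨ (∀ n, ∃ m ≤ n, HasInjResolutionLE K m) ∨
      ∃ n : ℤ, injDim K = ((n : WithTop ℤ) : WithBot (WithTop ℤ)) ∧ HasInjResolutionLE K n := by
  by_cases h : ∃ n, HasInjResolutionLE K n
  · right
    by_cases hb : ∃ b, ∀ n, HasInjResolutionLE K n → b ≤ n
    · right
      obtain ⟨n, hn, hmin⟩ := Int.exists_least_of_bdd hb h
      refine ⟨n, le_antisymm (injDim_le_coe hn) (le_sInf ?_), hn⟩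
      rintro _ ⟨m, rfl, hm⟩
      exact_mod_cast hmin m hm
    · left
      push Not at hb
      intro n
      obtain ⟨m, hm, hmn⟩ := hb n
      exact ⟨m, hmn.le, hm⟩
  · left
    push Not at h
    refine sInf_eq_top.2 ?_
    rintro _ ⟨n, -, hn⟩
    exact absurd hn (h n)

lemma injDim_eq_bot_iff {K : CochainComplex C ℤ} :
    injDim K = ⊥ ↔ ∀ n, ∃ m ≤ n, HasInjResolutionLE K m := by
  constructor
  · intro h
    obtain h' | h' | ⟨n, h', -⟩ := injDim_cases K
    · rw [h] at h'
      exact absurd h' (by decide)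
    · exact h'
    · rw [h] at h'
      exact absurd h'.symm (WithBot.coe_ne_bot)
  · intro h
    rw [eq_bot_iff, WithBot.le_bot_iff]
    by_contra h0
    obtain ⟨x, hx⟩ := WithBot.ne_bot_iff_exists.1 h0
    have hle : ∀ n : ℤ, x ≤ n := fun n => by
      obtain ⟨m, hm, hK⟩ := h n
      have := (injDim_le_coe hK)
      rw [← hx] at this
      exact (WithBot.coe_le_coe.1 this).trans (by exact_mod_cast hm)
    induction x with
    | top => exact absurd (hle 0) (by simp)
    | coe x =>
      have := hle (x - 1)
      have : x ≤ x - 1 := by exact_mod_cast this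
      lia

/-- A complex with injective resolutions in arbitrarily small degrees is acyclic. -/
lemma acyclic_of_injDim_eq_bot {K : CochainComplex C ℤ} (h : injDim K = ⊥) : K.Acyclic := by
  intro i
  obtain ⟨m, hm, I, f, hf, -, -, hI⟩ := injDim_eq_bot_iff.1 h (i - 1)
  rw [HomologicalComplex.exactAt_iff_isZero_homology]
  refine IsZero.of_iso ?_ (isoOfQuasiIsoAt f i)
  rw [← HomologicalComplex.exactAt_iff_isZero_homology]
  exact HomologicalComplex.ExactAt.of_isZero (hI i (by lia))

lemma injDim_eq_bot_of_acyclic {K : CochainComplex C ℤ} (h : K.Acyclic) : injDim K = ⊥ := by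
  rw [injDim_eq_bot_iff]
  intro n
  refine ⟨n, le_rfl, 0, 0, ⟨fun i => ?_⟩, ?_, ⟨0, ?_⟩, ?_⟩
  · rw [quasiIsoAt_iff_exactAt _ _ (h i)]
    exact HomologicalComplex.ExactAt.of_isZero
      ((HomologicalComplex.eval C (ComplexShape.up ℤ) i).map_isZero (isZero_zero _))
  · intro i
    exact ((HomologicalComplex.eval C (ComplexShape.up ℤ) i).map_isZero (isZero_zero _)).injective
  all_goals
    intro i _
    exact (HomologicalComplex.eval C (ComplexShape.up ℤ) i).map_isZero (isZero_zero _)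

end Homological
end GradedInjDim

/-! ### Graded vector spaces and graded modules of functions -/

namespace GradedInjDim

section Coefficients

variable {k G M N : Type u} [Field k] [AddCommGroup M] [Module k M] [AddCommGroup N] [Module k N]
variable {V : G → Submodule k M}

/-- Two linear maps which agree on homogeneous elements are equal. -/
lemma IsGrading.hom_ext (hV : IsGrading V) {N : Type*} [AddCommGroup N] [Module k N]
    {f f' : M →ₗ[k] N} (h : ∀ g, ∀ m ∈ V g, f m = f' m) : f = f' := by
  refine LinearMap.ext fun m => ?_
  have hm : m ∈ ⨆ g, V g := by rw [hV.iSup_eq_top]; trivial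
  exact (iSup_le h : (⨆ g, V g) ≤ LinearMap.eqLocus f f') hm

lemma IsGrading.induction (hV : IsGrading V) {P : M → Prop} (zero : P 0)
    (add : ∀ x y, P x → P y → P (x + y)) (of_mem : ∀ g, ∀ m ∈ V g, P m) (m : M) : P m := by
  have hm : m ∈ ⨆ g, V g := by rw [hV.iSup_eq_top]; trivial
  exact Submodule.iSup_induction V (motive := P) hm of_mem zero add

/-- Linear maps on a graded vector space can be prescribed on the homogeneous components. -/
lemma IsGrading.exists_lift (hV : IsGrading V) {N : Type*} [AddCommGroup N] [Module k N]
    (t : G → M →ₗ[k] N) : ∃ f : M →ₗ[k] N, ∀ g, ∀ m ∈ V g, f m = t g m := by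
  classical
  have hint := DirectSum.isInternal_submodule_of_iSupIndep_of_iSup_eq_top hV.indep hV.iSup_eq_top
  let e := LinearEquiv.ofBijective (DirectSum.coeLinearMap V) hint
  refine ⟨DirectSum.toModule k G N (fun g => t g ∘ₗ (V g).subtype) ∘ₗ e.symm.toLinearMap,
    fun g m hm => ?_⟩
  have : e.symm m = DirectSum.lof k G (fun g => V g) g ⟨m, hm⟩ := by
    rw [LinearEquiv.symm_apply_eq]
    exact (DirectSum.coeLinearMap_lof V g ⟨m, hm⟩).symm
  simp [this, DirectSum.toModule_lof]

/-- The linear map which is given by `t g` on the component of degree `g`. -/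
noncomputable def IsGrading.lift (hV : IsGrading V) {N : Type*} [AddCommGroup N] [Module k N]
    (t : G → M →ₗ[k] N) : M →ₗ[k] N := (hV.exists_lift t).choose

lemma IsGrading.lift_of_mem (hV : IsGrading V) {N : Type*} [AddCommGroup N] [Module k N]
    (t : G → M →ₗ[k] N) {g : G} {m : M} (hm : m ∈ V g) : hV.lift t m = t g m :=
  (hV.exists_lift t).choose_spec g m hm

/-- The family of the homogeneous components of an element. -/
noncomputable def IsGrading.coeff (hV : IsGrading V) : M →ₗ[k] (G →₀ M) :=
  hV.lift fun g => Finsupp.lsingle g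

lemma IsGrading.coeff_of_mem (hV : IsGrading V) {g : G} {m : M} (hm : m ∈ V g) :
    hV.coeff m = Finsupp.single g m := hV.lift_of_mem _ hm

lemma IsGrading.coeff_mem (hV : IsGrading V) (m : M) (g : G) : hV.coeff m g ∈ V g := by
  classical
  induction m using hV.induction with
  | zero => simp
  | add x y hx hy => simpa using Submodule.add_mem _ hx hy
  | of_mem g' m hm =>
    rw [hV.coeff_of_mem hm, Finsupp.single_apply]
    split_ifs with h
    · exact h ▸ hm
    · exact Submodule.zero_mem _

lemma IsGrading.sum_coeff (hV : IsGrading V) (m : M) : (hV.coeff m).sum (fun _ x => x) = m := by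
  induction m using hV.induction with
  | zero => simp
  | add x y hx hy => rw [map_add, Finsupp.sum_add_index' (by simp) (by simp), hx, hy]
  | of_mem g m hm => rw [hV.coeff_of_mem hm]; simp

lemma IsGrading.coeff_self (hV : IsGrading V) {g : G} {m : M} (hm : m ∈ V g) :
    hV.coeff m g = m := by
  rw [hV.coeff_of_mem hm, Finsupp.single_eq_same]

lemma IsGrading.coeff_of_ne (hV : IsGrading V) {g g' : G} {m : M} (hm : m ∈ V g) (h : g' ≠ g) :
    hV.coeff m g' = 0 := by
  rw [hV.coeff_of_mem hm, Finsupp.single_eq_of_ne h]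

lemma IsGrading.map_coeff {W : G → Submodule k N} (hV : IsGrading V) (hW : IsGrading W)
    (f : M →ₗ[k] N) (hf : ∀ g, ∀ m ∈ V g, f m ∈ W g) (m : M) (g : G) :
    f (hV.coeff m g) = hW.coeff (f m) g := by
  classical
  induction m using hV.induction with
  | zero => simp
  | add x y hx hy => simp [hx, hy]
  | of_mem g' m hm =>
    rw [hV.coeff_of_mem hm, hW.coeff_of_mem (hf g' m hm)]
    simp only [Finsupp.single_apply]
    split_ifs <;> simp

/-- The elements of degree `h` for the grading induced along `φ` are those whose components have
degrees in `φ⁻¹(h)`. -/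
lemma IsGrading.mem_pushGrading_iff (hV : IsGrading V) {H : Type u} (φ : G → H) (h : H) (m : M) :
    m ∈ pushGrading φ V h ↔ ∀ g, φ g ≠ h → hV.coeff m g = 0 := by
  constructor
  · intro hm g hg
    have hle : pushGrading φ V h ≤
        LinearMap.ker ((Finsupp.lapply g : (G →₀ M) →ₗ[k] M) ∘ₗ hV.coeff) := by
      refine iSup₂_le fun g' hg' m hm => ?_
      rw [LinearMap.mem_ker, LinearMap.comp_apply, Finsupp.lapply_apply]
      exact hV.coeff_of_ne hm (by rintro rfl; exact hg hg')
    exact hle hm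
  · intro hm
    rw [← hV.sum_coeff m]
    refine Submodule.sum_mem _ fun g hg => ?_
    have hg' : φ g = h := by
      by_contra h'
      exact Finsupp.mem_support_iff.1 hg (hm g h')
    exact (le_iSup₂_of_le (f := fun (x : G) (_ : φ x = h) => V x) g hg' le_rfl)
      (hV.coeff_mem m g)

lemma mem_pushGrading_of_mem {H : Type u} {φ : G → H} {g : G} {h : H} (hg : φ g = h)
    {m : M} (hm : m ∈ V g) : m ∈ pushGrading φ V h :=
  (le_iSup₂_of_le (f := fun (x : G) (_ : φ x = h) => V x) g hg le_rfl) hm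

end Coefficients

variable {k G H A : Type u} [Field k] [AddGroup G] [AddGroup H] [Ring A] [Algebra k A]
variable {𝒜 : G → Submodule k A}

-- The grading of `A` is recorded as `Fact (IsGrading 𝒜)` with `SetLike.GradedMonoid 𝒜`: unlike
-- `GradedAlgebra 𝒜`, which contains a choice of projections, this is inherited by `φ_!(𝒜)`.
instance (φ : G →+ H) [SetLike.GradedMonoid 𝒜] : SetLike.GradedMonoid (pushGrading φ 𝒜) :=
  gradedMonoid_push 𝒜 φ

instance (φ : G →+ H) [h𝒜 : Fact (IsGrading 𝒜)] : Fact (IsGrading (pushGrading φ 𝒜)) :=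
  ⟨h𝒜.out.push φ⟩

/-- A `k`-linear map which commutes with homogeneous scalars is `A`-linear. -/
def linearMapOfHomogeneous (h𝒜 : IsGrading 𝒜) {M N : Type*} [AddCommGroup M] [Module k M]
    [Module A M] [IsScalarTower k A M] [AddCommGroup N] [Module k N] [Module A N]
    [IsScalarTower k A N] (f : M →ₗ[k] N)
    (hf : ∀ g, ∀ a ∈ 𝒜 g, ∀ m, f (a • m) = a • f m) : M →ₗ[A] N where
  __ := f
  map_smul' a m := by
    simp only [AddHom.toFun_eq_coe, LinearMap.coe_toAddHom, RingHom.id_apply]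
    induction a using h𝒜.induction with
    | zero => simp
    | add x y hx hy => simp only [add_smul, map_add, hx, hy]
    | of_mem g a ha => exact hf g a ha m

/-- The functions `G → X` with values in an `A`-module `X`. The algebra `A` acts through the
coaction `A → A ⊗ k[G]`, i.e. `(a • f) x = a • f (-g + x)` for `a` of degree `g`. -/
def GFun (_𝒜 : G → Submodule k A) (X : Type u) : Type u := G → X

namespace GFun

variable {X : Type u} [AddCommGroup X] [Module k X] [Module A X] [IsScalarTower k A X]

instance : AddCommGroup (GFun 𝒜 X) := inferInstanceAs (AddCommGroup (G → X))

instance : Module k (GFun 𝒜 X) := inferInstanceAs (Module k (G → X))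

lemma ext {f f' : GFun 𝒜 X} (h : ∀ x, f x = f' x) : f = f' := funext h

/-- The action of the elements of degree `g`. -/
def actDeg (𝒜 : G → Submodule k A) (X : Type u) [AddCommGroup X] [Module k X] [Module A X]
    [IsScalarTower k A X] (g : G) : A →ₗ[k] Module.End k (GFun 𝒜 X) :=
  LinearMap.mk₂ k (fun a f => (fun x => a • f (-g + x) : G → X))
    (fun _ _ _ => ext fun _ => add_smul _ _ _)
    (fun _ _ _ => ext fun _ => smul_assoc _ _ _)
    (fun _ _ _ => ext fun _ => smul_add _ _ _)
    (fun _ _ _ => ext fun _ => smul_comm _ _ _)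

lemma actDeg_apply (g : G) (a : A) (f : GFun 𝒜 X) (x : G) :
    actDeg 𝒜 X g a f x = a • f (-g + x) := rfl

variable [h𝒜 : Fact (IsGrading 𝒜)]

/-- The action of `A` on `GFun 𝒜 X`. -/
noncomputable def act (𝒜 : G → Submodule k A) [h𝒜 : Fact (IsGrading 𝒜)] (X : Type u)
    [AddCommGroup X] [Module k X] [Module A X] [IsScalarTower k A X] :
    A →ₗ[k] Module.End k (GFun 𝒜 X) :=
  h𝒜.out.lift (actDeg 𝒜 X)

lemma act_of_mem {g : G} {a : A} (ha : a ∈ 𝒜 g) : act 𝒜 X a = actDeg 𝒜 X g a :=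
  h𝒜.out.lift_of_mem _ ha

variable [SetLike.GradedMonoid 𝒜]

lemma act_one : act 𝒜 X 1 = 1 := by
  rw [act_of_mem (SetLike.GradedOne.one_mem (A := 𝒜))]
  refine LinearMap.ext fun f => ext fun x => ?_
  simp [actDeg_apply]

lemma act_mul (a b : A) : act 𝒜 X (a * b) = act 𝒜 X a * act 𝒜 X b := by
  induction a using h𝒜.out.induction with
  | zero => simp
  | add x y hx hy => rw [add_mul, map_add, map_add, hx, hy, add_mul]
  | of_mem g a ha =>
    induction b using h𝒜.out.induction with
    | zero => simp
    | add x y hx hy => rw [mul_add, map_add, map_add, hx, hy, mul_add]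
    | of_mem g' b hb =>
      rw [act_of_mem (SetLike.GradedMul.mul_mem ha hb), act_of_mem ha, act_of_mem hb]
      refine LinearMap.ext fun f => ext fun x => ?_
      rw [Module.End.mul_apply]
      simp only [actDeg_apply, mul_smul, neg_add_rev, add_assoc]

noncomputable instance : Module A (GFun 𝒜 X) where
  smul a f := act 𝒜 X a f
  one_smul f := by
    change act 𝒜 X 1 f = f
    rw [act_one, Module.End.one_apply]
  mul_smul a b f := by
    change act 𝒜 X (a * b) f = act 𝒜 X a (act 𝒜 X b f)
    rw [act_mul, Module.End.mul_apply]
  smul_zero a := map_zero (act 𝒜 X a)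
  smul_add a := map_add (act 𝒜 X a)
  add_smul a b f := by
    change act 𝒜 X (a + b) f = act 𝒜 X a f + act 𝒜 X b f
    rw [map_add, LinearMap.add_apply]
  zero_smul f := by
    change act 𝒜 X 0 f = 0
    rw [map_zero, LinearMap.zero_apply]

instance : IsScalarTower k A (GFun 𝒜 X) where
  smul_assoc c a f := by
    change act 𝒜 X (c • a) f = c • act 𝒜 X a f
    rw [map_smul, LinearMap.smul_apply]

lemma smul_apply {g : G} {a : A} (ha : a ∈ 𝒜 g) (f : GFun 𝒜 X) (x : G) :
    (a • f) x = a • f (-g + x) := by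
  change act 𝒜 X a f x = _
  rw [act_of_mem ha, actDeg_apply]

end GFun

section FunData

instance (φ : G →+ H) : Fact (∀ h, pushGrading φ 𝒜 h ≤ pushGrading φ 𝒜 h) := ⟨fun _ => le_rfl⟩

instance : Fact (∀ g, 𝒜 g ≤ pushGrading (AddMonoidHom.id G) 𝒜 g) :=
  ⟨fun _ _ ha => mem_pushGrading_of_mem rfl ha⟩

variable [Fact (IsGrading 𝒜)] [SetLike.GradedMonoid 𝒜]

/-- A space of functions `G → X` which is stable under `A` and is `H`-graded by the
restrictions of functions to the fibres of `φ : G → H`. -/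
structure FunData (𝒜 : G → Submodule k A) [Fact (IsGrading 𝒜)] [SetLike.GradedMonoid 𝒜]
    (φ : G →+ H) (X : Type u) [AddCommGroup X] [Module k X] [Module A X]
    [IsScalarTower k A X] where
  /-- the space of functions -/
  space : Submodule k (GFun 𝒜 X)
  smul_mem : ∀ g, ∀ a ∈ 𝒜 g, ∀ f ∈ space, a • f ∈ space
  restrict_mem : ∀ h, ∀ f ∈ space, ∀ f' : GFun 𝒜 X, (∀ x, φ x = h → f' x = f x) →
    (∀ x, φ x ≠ h → f' x = 0) → f' ∈ space
  finite : ∀ f ∈ space, (φ '' Function.support f).Finite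

variable {φ : G →+ H} {X : Type u} [AddCommGroup X] [Module k X] [Module A X]
  [IsScalarTower k A X]

namespace FunData

variable (D : FunData 𝒜 φ X)

/-- The functions in `D.space` as an `A`-module. -/
def submodule : Submodule A (GFun 𝒜 X) where
  __ := D.space
  smul_mem' a f hf := by
    simp only [AddSubsemigroup.mem_carrier, AddSubmonoid.mem_toSubsemigroup,
      Submodule.mem_toAddSubmonoid] at hf ⊢
    induction a using (Fact.out : IsGrading 𝒜).induction with
    | zero => simp
    | add x y hx hy => rw [add_smul]; exact add_mem hx hy
    | of_mem g a ha => exact D.smul_mem g a ha f hf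

/-- The functions supported on `φ⁻¹(h)`. -/
def comp (h : H) : Submodule k D.submodule where
  carrier := {f | ∀ x, φ x ≠ h → f.1 x = 0}
  add_mem' {f f'} hf hf' x hx := by
    change f.1 x + f'.1 x = 0
    rw [hf x hx, hf' x hx, add_zero]
  zero_mem' x _ := rfl
  smul_mem' c f hf x hx := by
    change c • f.1 x = 0
    rw [hf x hx, smul_zero]

open Classical in
/-- Restriction of functions to `φ⁻¹(h)`. -/
noncomputable def restrict (h : H) : D.submodule →ₗ[k] D.submodule where
  toFun f := ⟨(fun x => if φ x = h then f.1 x else 0 : G → X), D.restrict_mem h f.1 f.2 _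
    (fun _ hx => if_pos hx) (fun _ hx => if_neg hx)⟩
  map_add' f f' := Subtype.ext <| GFun.ext fun x => by
    change ite _ (f.1 x + f'.1 x) _ = ite _ _ _ + ite _ _ _
    split_ifs <;> simp
  map_smul' c f := Subtype.ext <| GFun.ext fun x => by
    change ite _ (c • f.1 x) _ = c • ite _ _ _
    split_ifs <;> simp

open Classical in
lemma restrict_apply (h : H) (f : D.submodule) (x : G) :
    (D.restrict h f).1 x = if φ x = h then f.1 x else 0 := rfl

lemma isGrading : IsGrading D.comp := by
  classical
  refine IsGrading.of_proj D.restrict (fun h f hf => Subtype.ext (GFun.ext fun x => ?_))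
    (fun h h' hh f hf => Subtype.ext (GFun.ext fun x => ?_)) (fun f => ?_)
  · rw [restrict_apply]
    split_ifs with hx
    · rfl
    · exact (hf x hx).symm
  · rw [restrict_apply]
    split_ifs with hx
    · exact hf x (by rw [hx]; exact hh)
    · rfl
  · have : f = ∑ h ∈ (D.finite f.1 f.2).toFinset, D.restrict h f := by
      refine Subtype.ext (GFun.ext fun x => ?_)
      have hev : ∀ s : Finset H, (∑ h ∈ s, D.restrict h f).1 x = ∑ h ∈ s, (D.restrict h f).1 x := by
        intro s
        induction s using Finset.induction with
        | empty => rfl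
        | insert h s hs ih => rw [Finset.sum_insert hs, Finset.sum_insert hs, ← ih]; rfl
      rw [hev]
      simp only [restrict_apply]
      rw [Finset.sum_ite_eq]
      split_ifs with hx
      · rfl
      · by_contra h0
        exact hx ((Set.Finite.mem_toFinset _).2 ⟨x, h0, rfl⟩)
    rw [this]
    refine Submodule.sum_mem _ fun h _ => Submodule.mem_iSup_of_mem h fun x hx => ?_
    rw [restrict_apply, if_neg hx]

/-- The graded module of functions given by `D`. The algebra `A` can be graded by any `ℬ`
contained in `φ_!(𝒜)`; this is used for `φ_!(𝒜)` itself, and for `𝒜` if `φ` is the identity. -/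
noncomputable def grMod (ℬ : H → Submodule k A)
    [hℬ : Fact (∀ h, ℬ h ≤ pushGrading φ 𝒜 h)] : GrMod ℬ where
  carrier := D.submodule
  comp := D.comp
  isGrading := D.isGrading
  smul_mem {h h' a f} ha hf := by
    have hle : pushGrading φ 𝒜 h ≤ (D.comp (h + h')).comap
        ((LinearMap.toSpanSingleton A D.submodule f).restrictScalars k) := by
      refine iSup₂_le fun g hg a ha x hx => ?_
      change (a • f.1) x = 0
      rw [GFun.smul_apply ha, hf _ ?_, smul_zero]
      intro h0
      apply hx
      rw [← h0, ← hg, ← map_add, add_neg_cancel_left]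
    exact hle (hℬ.out h ha)

section

variable {D} {ℬ : H → Submodule k A} [hℬ : Fact (∀ h, ℬ h ≤ pushGrading φ 𝒜 h)]

/-- An element of `D.grMod ℬ` as a function. -/
def fn (f : (D.grMod ℬ).carrier) : GFun 𝒜 X := Subtype.val (p := (· ∈ D.submodule)) f

/-- The element of `D.grMod ℬ` given by a function in `D.space`. -/
def toElem (f : GFun 𝒜 X) (hf : f ∈ D.space) : (D.grMod ℬ).carrier :=
  Subtype.mk (p := (· ∈ D.submodule)) f hf

lemma fn_injective {f f' : (D.grMod ℬ).carrier} (h : ∀ x, fn f x = fn f' x) : f = f' :=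
  Subtype.ext (GFun.ext h)

lemma fn_mem (f : (D.grMod ℬ).carrier) : fn f ∈ D.space :=
  Subtype.property (p := (· ∈ D.submodule)) f

lemma mem_comp_iff {h : H} {f : (D.grMod ℬ).carrier} :
    f ∈ (D.grMod ℬ).comp h ↔ ∀ x, φ x ≠ h → fn f x = 0 := Iff.rfl

lemma fn_smul (a : A) (f : (D.grMod ℬ).carrier) : fn (a • f) = a • fn f := rfl

lemma fn_smul_apply {g : G} {a : A} (ha : a ∈ 𝒜 g) (f : (D.grMod ℬ).carrier) (x : G) :
    fn (a • f) x = a • fn f (-g + x) := GFun.smul_apply ha (fn f) x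

variable (D ℬ) in
/-- The value at `x`. -/
noncomputable def evalAt (x : G) : (D.grMod ℬ).carrier →ₗ[k] X where
  toFun f := fn f x
  map_add' _ _ := rfl
  map_smul' _ _ := rfl

lemma evalAt_apply (x : G) (f : (D.grMod ℬ).carrier) : D.evalAt ℬ x f = fn f x := rfl

/-- A morphism to `D.grMod ℬ` from a family of `k`-linear maps, one for each `x : G`. -/
noncomputable def lift {N : GrMod ℬ} (t : G → N.carrier →ₗ[k] X)
    (ht : ∀ n, (fun x => t x n : G → X) ∈ D.space)
    (hsmul : ∀ g, ∀ a ∈ 𝒜 g, ∀ n x, t x (a • n) = a • t (-g + x) n)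
    (hcomp : ∀ h, ∀ n ∈ N.comp h, ∀ x, φ x ≠ h → t x n = 0) : N ⟶ D.grMod ℬ :=
  GrMod.ofLin (linearMapOfHomogeneous (M := N.carrier) (N := (D.grMod ℬ).carrier)
    (Fact.out : IsGrading 𝒜)
    { toFun := fun n => toElem _ (ht n)
      map_add' := fun n n' => fn_injective fun x => map_add (t x) n n'
      map_smul' := fun c n => fn_injective fun x => map_smul (t x) c n }
    fun g a ha n => fn_injective fun x => by
      rw [fn_smul, GFun.smul_apply ha]
      exact hsmul g a ha n x) hcomp

/-- The morphism given by composition with an `A`-linear map. -/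
noncomputable def map {X' : Type u} [AddCommGroup X'] [Module k X'] [Module A X']
    [IsScalarTower k A X'] {D' : FunData 𝒜 φ X'} (e : X →ₗ[A] X')
    (he : ∀ f ∈ D.space, (fun x => e (f x) : G → X') ∈ D'.space) :
    D.grMod ℬ ⟶ D'.grMod ℬ :=
  lift (fun x => e.restrictScalars k ∘ₗ D.evalAt ℬ x) (fun f => he _ (fn_mem f))
    (fun g a ha f x => by
      rw [LinearMap.comp_apply, evalAt_apply, fn_smul, GFun.smul_apply ha]
      exact map_smul e a _)
    (fun h f hf x hx => by
      rw [LinearMap.comp_apply, evalAt_apply, mem_comp_iff.1 hf x hx, map_zero])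

end

end FunData

end FunData

namespace GrMod

lemma mono_of_injective {M N : GrMod 𝒜} (f : M ⟶ N) (hf : Function.Injective (lin f)) : Mono f :=
  ⟨fun _ _ h => hom_ext fun z => hf (congrArg (fun u => lin u z) h)⟩

lemma epi_of_surjective {M N : GrMod 𝒜} (f : M ⟶ N) (hf : Function.Surjective (lin f)) : Epi f :=
  ⟨fun s t h => hom_ext fun z => by
    obtain ⟨m, rfl⟩ := hf z
    exact congrArg (fun u => lin u m) h⟩

lemma isIso_of_bijective {M N : GrMod 𝒜} (f : M ⟶ N) (hf : Function.Bijective (lin f)) :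
    IsIso f :=
  have := mono_of_injective f hf.1
  have := epi_of_surjective f hf.2
  isIso_of_mono_of_epi f

/-- Exactness of a short complex of graded modules can be tested on elements. -/
lemma exact_iff (S : ShortComplex (GrMod 𝒜)) :
    S.Exact ↔ ∀ y, lin S.g y = 0 → ∃ x, lin S.f x = y := by
  let hi := isLimitOfInjective (kerι S.g) S.g Subtype.val_injective (range_kerι S.g)
    (kerι_comp S.g)
  let f' : S.X₁ ⟶ kerObj S.g := hi.lift (KernelFork.ofι S.f S.zero)
  have hf' : f' ≫ kerι S.g = S.f := hi.fac (KernelFork.ofι S.f S.zero) WalkingParallelPair.zero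
  let h : S.LeftHomologyData :=
    { K := kerObj S.g
      H := cokernel f'
      i := kerι S.g
      π := cokernel.π f'
      wi := kerι_comp S.g
      hi := hi
      wπ := cokernel.condition f'
      hπ := cokernelIsCokernel f' }
  rw [h.exact_iff_epi_f']
  change Epi f' ↔ _
  constructor
  · intro _ y hy
    obtain ⟨x, hx⟩ := surjective_of_epi f' (⟨y, hy⟩ : LinearMap.ker (lin S.g))
    refine ⟨x, ?_⟩
    rw [← hf', lin_comp, hx]
    rfl
  · intro hS
    refine epi_of_surjective f' ?_
    rintro ⟨y, hy⟩
    obtain ⟨x, hx⟩ := hS y hy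
    exact ⟨x, Subtype.ext ((congrArg (fun u => lin u x) hf').trans hx)⟩

/-- An additive functor between categories of graded modules is exact if it preserves exactness
tested on elements. -/
lemma preservesHomology_of_exact {ℬ : H → Submodule k A} (F : GrMod 𝒜 ⥤ GrMod ℬ) [F.Additive]
    (h : ∀ (M N P : GrMod 𝒜) (f : M ⟶ N) (g : N ⟶ P), f ≫ g = 0 →
      (∀ y, lin g y = 0 → ∃ x, lin f x = y) →
      ∀ y, lin (F.map g) y = 0 → ∃ x, lin (F.map f) x = y) : F.PreservesHomology :=
  (F.exact_tfae.out 1 2).1 fun S hS =>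
    (exact_iff _).2 (h _ _ _ S.f S.g S.zero ((exact_iff S).1 hS))

end GrMod
end GradedInjDim

/-! ### Injective graded modules and families of subspaces -/

namespace GradedInjDim

namespace GrMod

variable {k G H A : Type u} [Field k] [AddGroup G] [AddGroup H] [Ring A] [Algebra k A]
variable {𝒜 : G → Submodule k A}

section Maps

variable [h𝒜 : Fact (IsGrading 𝒜)]
variable {X : Type u} [AddCommGroup X] [Module k X] [Module A X] [IsScalarTower k A X]

/-- An `A`-linear map on a graded module which is prescribed on the homogeneous components. -/
noncomputable def liftLinear (M : GrMod 𝒜) (t : G → M.carrier →ₗ[k] X)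
    (ht : ∀ g, ∀ a ∈ 𝒜 g, ∀ g', ∀ m ∈ M.comp g', t (g + g') (a • m) = a • t g' m) :
    M.carrier →ₗ[A] X :=
  linearMapOfHomogeneous h𝒜.out (M.isGrading.lift t) fun g a ha m => by
    induction m using M.isGrading.induction with
    | zero => simp
    | add x y hx hy => rw [smul_add, map_add, map_add, hx, hy, smul_add]
    | of_mem g' m hm =>
      rw [M.isGrading.lift_of_mem t hm, M.isGrading.lift_of_mem t (M.smul_mem ha hm),
        ht g a ha g' m hm]

lemma liftLinear_of_mem (M : GrMod 𝒜) (t : G → M.carrier →ₗ[k] X) (ht) {g : G} {m : M.carrier}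
    (hm : m ∈ M.comp g) : liftLinear M t ht m = t g m :=
  M.isGrading.lift_of_mem t hm

/-- `A`-linear maps on a graded module are determined by their values on homogeneous elements. -/
lemma linear_ext {ℬ : H → Submodule k A} {M : GrMod ℬ} {f f' : M.carrier →ₗ[A] X}
    (h : ∀ g, ∀ m ∈ M.comp g, f m = f' m) : f = f' :=
  LinearMap.restrictScalars_injective k (M.isGrading.hom_ext h)

end Maps

lemma coeff_smul (M : GrMod 𝒜) {g : G} {a : A} (ha : a ∈ 𝒜 g) (m : M.carrier) (x : G) :
    M.isGrading.coeff (a • m) x = a • M.isGrading.coeff m (-g + x) := by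
  induction m using M.isGrading.induction with
  | zero => simp
  | add y z hy hz => rw [smul_add, map_add, Finsupp.add_apply, hy, hz, ← smul_add,
      ← Finsupp.add_apply, ← map_add]
  | of_mem g' m hm =>
    by_cases h : x = g + g'
    · subst h
      rw [neg_add_cancel_left, M.isGrading.coeff_self (M.smul_mem ha hm),
        M.isGrading.coeff_self hm]
    · rw [M.isGrading.coeff_of_ne (M.smul_mem ha hm) h, M.isGrading.coeff_of_ne hm, smul_zero]
      rintro rfl
      exact h (add_neg_cancel_left _ _).symm

lemma lin_coeff {M N : GrMod 𝒜} (f : M ⟶ N) (m : M.carrier) (g : G) :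
    lin f (M.isGrading.coeff m g) = N.isGrading.coeff (lin f m) g :=
  M.isGrading.map_coeff N.isGrading ((lin f).restrictScalars k) f.map_mem m g

/-- Exactness in each degree. -/
lemma exists_mem_comp_of_exact {M N P : GrMod 𝒜} {f : M ⟶ N} {g : N ⟶ P}
    (h : ∀ y, lin g y = 0 → ∃ x, lin f x = y) {x : G} {y : N.carrier} (hy : y ∈ N.comp x)
    (hy0 : lin g y = 0) : ∃ z ∈ M.comp x, lin f z = y := by
  obtain ⟨z, rfl⟩ := h y hy0
  refine ⟨M.isGrading.coeff z x, M.isGrading.coeff_mem z x, ?_⟩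
  rw [lin_coeff, N.isGrading.coeff_self hy]

section Cofree

variable [h𝒜 : Fact (IsGrading 𝒜)] [SetLike.GradedMonoid 𝒜]
variable {X : Type u} [AddCommGroup X] [Module k X] [Module A X] [IsScalarTower k A X]

/-- A family of subspaces `W g` of an `A`-module `X` with `𝒜 g • W g' ⊆ W (g + g')`; the `W g` need
neither be independent nor span `X`. -/
structure Family (𝒜 : G → Submodule k A) (X : Type u) [AddCommGroup X] [Module k X]
    [Module A X] where
  /-- the subspaces -/
  sub : G → Submodule k X
  smul_mem : ∀ {g g' : G} {a : A} {x : X}, a ∈ 𝒜 g → x ∈ sub g' → a • x ∈ sub (g + g')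

/-- The functions `f` with `f g ∈ W g`, whose support has finite image under `φ`. -/
def Family.funData (W : Family 𝒜 X) (φ : G →+ H) : FunData 𝒜 φ X where
  space :=
    { carrier := {f | (∀ g, f g ∈ W.sub g) ∧ (φ '' Function.support f).Finite}
      add_mem' := fun {f f'} hf hf' => ⟨fun g => Submodule.add_mem _ (hf.1 g) (hf'.1 g),
        (hf.2.union hf'.2).subset (by
          rw [← Set.image_union]
          exact Set.image_mono (Function.support_add _ _))⟩
      zero_mem' := ⟨fun g => Submodule.zero_mem _, by
        rw [show Function.support (0 : GFun 𝒜 X) = ∅ from Function.support_zero, Set.image_empty]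
        exact Set.finite_empty⟩
      smul_mem' := fun c f hf => ⟨fun g => Submodule.smul_mem _ _ (hf.1 g),
        hf.2.subset (Set.image_mono (Function.support_const_smul_subset c f))⟩ }
  smul_mem g a ha f hf := by
    refine ⟨fun x => ?_, ?_⟩
    · rw [GFun.smul_apply ha]
      have := W.smul_mem ha (hf.1 (-g + x))
      rwa [add_neg_cancel_left] at this
    · refine (hf.2.image (φ g + ·)).subset ?_
      rintro _ ⟨x, hx, rfl⟩
      refine ⟨φ (-g + x), ⟨-g + x, fun h => hx ?_, rfl⟩, by simp⟩
      rw [GFun.smul_apply ha, h, smul_zero]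
  restrict_mem h f hf f' h₁ h₂ := by
    refine ⟨fun x => ?_, hf.2.subset (Set.image_mono fun x hx h0 => hx ?_)⟩
    · by_cases hx : φ x = h
      · rw [h₁ x hx]
        exact hf.1 x
      · rw [h₂ x hx]
        exact Submodule.zero_mem _
    · by_cases hx : φ x = h
      · rw [h₁ x hx, h0]
      · exact h₂ x hx
  finite f hf := hf.2

/-- The graded module `⨁ g, W g`. It represents the functor which sends `M` to the `A`-linear
maps `M → X` mapping `M_g` to `W g`. -/
noncomputable abbrev Family.sum (W : Family 𝒜 X) : GrMod 𝒜 :=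
  (W.funData (AddMonoidHom.id G)).grMod 𝒜

namespace Family

open FunData

variable {W : Family 𝒜 X}

variable (W)

/-- The universal map `⨁ g, W g → X`. -/
noncomputable def eval : W.sum.carrier →ₗ[A] X :=
  liftLinear W.sum (evalAt _ _) fun g a ha g' f hf => by
    rw [evalAt_apply, evalAt_apply, fn_smul, GFun.smul_apply ha, neg_add_cancel_left]

lemma eval_of_mem {g : G} {f : W.sum.carrier} (hf : f ∈ W.sum.comp g) : W.eval f = fn f g :=
  liftLinear_of_mem _ _ _ hf

variable {W}

/-- The morphism to `⨁ g, W g` which corresponds to an `A`-linear map to `X`. -/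
noncomputable def lift {M : GrMod 𝒜} (u : M.carrier →ₗ[A] X)
    (hu : ∀ g, ∀ m ∈ M.comp g, u m ∈ W.sub g) : M ⟶ W.sum :=
  FunData.lift (fun x => u.restrictScalars k ∘ₗ Finsupp.lapply x ∘ₗ M.isGrading.coeff)
    (fun m => ⟨fun g => hu g _ (M.isGrading.coeff_mem m g), Set.Finite.image _
      ((M.isGrading.coeff m).hasFiniteSupport.subset fun g hg h0 => hg (by
        change u (M.isGrading.coeff m g) = 0
        rw [h0, map_zero]))⟩)
    (fun g a ha m x => by
      change u (M.isGrading.coeff (a • m) x) = a • u (M.isGrading.coeff m (-g + x))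
      rw [coeff_smul M ha, map_smul])
    (fun g m hm x hx => by
      change u (M.isGrading.coeff m x) = 0
      rw [M.isGrading.coeff_of_ne hm (show x ≠ g from hx), map_zero])

lemma fn_lift {M : GrMod 𝒜} (u : M.carrier →ₗ[A] X)
    (hu : ∀ g, ∀ m ∈ M.comp g, u m ∈ W.sub g) (m : M.carrier) (x : G) :
    fn (lin (lift u hu) m) x = u (M.isGrading.coeff m x) := rfl

lemma eval_lift {M : GrMod 𝒜} (u : M.carrier →ₗ[A] X)
    (hu : ∀ g, ∀ m ∈ M.comp g, u m ∈ W.sub g) : W.eval ∘ₗ lin (lift u hu) = u :=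
  linear_ext fun g m hm => by
    rw [LinearMap.comp_apply, eval_of_mem W ((lift u hu).map_mem g m hm), fn_lift,
      M.isGrading.coeff_self hm]

lemma eval_mem {g : G} {f : W.sum.carrier} (hf : f ∈ W.sum.comp g) : W.eval f ∈ W.sub g := by
  rw [eval_of_mem W hf]
  exact (fn_mem f).1 g

lemma hom_ext_eval {M : GrMod 𝒜} {v v' : M ⟶ W.sum}
    (h : W.eval ∘ₗ lin v = W.eval ∘ₗ lin v') : v = v' :=
  lin_injective <| linear_ext fun g m hm => fn_injective fun x => by
    by_cases hx : x = g
    · subst hx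
      have := LinearMap.congr_fun h m
      rwa [LinearMap.comp_apply, LinearMap.comp_apply, eval_of_mem W (v.map_mem x m hm),
        eval_of_mem W (v'.map_mem x m hm)] at this
    · rw [mem_comp_iff.1 (v.map_mem g m hm) x hx, mem_comp_iff.1 (v'.map_mem g m hm) x hx]

/-- `⨁ g, W g` is injective if and only if `A`-linear maps to `X` which are homogeneous with
respect to `W` can be extended. -/
lemma injective_sum_iff : Injective W.sum ↔
    ∀ (M N : GrMod 𝒜) (i : M ⟶ N), Function.Injective (lin i) →
      ∀ u : M.carrier →ₗ[A] X, (∀ g, ∀ m ∈ M.comp g, u m ∈ W.sub g) →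
        ∃ w : N.carrier →ₗ[A] X, (∀ g, ∀ m ∈ N.comp g, w m ∈ W.sub g) ∧ w ∘ₗ lin i = u := by
  constructor
  · intro _ M N i hi u hu
    have := mono_of_injective i hi
    refine ⟨W.eval ∘ₗ lin (Injective.factorThru (lift u hu) i),
      fun g m hm => eval_mem (Hom.map_mem _ g m hm), ?_⟩
    have h := congrArg (fun v => W.eval ∘ₗ lin v) (Injective.comp_factorThru (lift u hu) i)
    exact h.trans (eval_lift u hu)
  · intro h
    refine ⟨fun {M N} v i _ => ?_⟩
    obtain ⟨w, hw, hwi⟩ := h M N i (injective_of_mono i) (W.eval ∘ₗ lin v)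
      fun g m hm => eval_mem (v.map_mem g m hm)
    refine ⟨lift w hw, hom_ext_eval ?_⟩
    rw [← hwi]
    conv_rhs => rw [← eval_lift w hw]
    rfl

end Family

/-- Graded modules embed into the injective modules `⨁ g, J` for injective `A`-modules `J`. -/
instance : EnoughInjectives (GrMod 𝒜) where
  presentation M := by
    let P := EnoughInjectives.presentation (ModuleCat.of A M.carrier)
    let J : ModuleCat A := P.some.J
    let _ : Module k J := Module.compHom J (algebraMap k A)
    have : IsScalarTower k A J := ⟨fun c a x => by
      rw [Algebra.smul_def, mul_smul]; rfl⟩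
    let W : Family 𝒜 J := ⟨fun _ => ⊤, fun _ _ => trivial⟩
    let f : M.carrier →ₗ[A] J := P.some.f.hom
    have hf : Function.Injective f := (ModuleCat.mono_iff_injective P.some.f).1 inferInstance
    refine ⟨⟨W.sum, ?_, Family.lift f fun _ _ _ => trivial, ?_⟩⟩
    · rw [Family.injective_sum_iff]
      intro M N i hi u _
      have : Mono (ModuleCat.ofHom (lin i)) := (ModuleCat.mono_iff_injective _).2 hi
      have hJ : Injective J := P.some.injective
      refine ⟨(Injective.factorThru (ModuleCat.ofHom u : _ ⟶ J) (ModuleCat.ofHom (lin i))).hom,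
        fun _ _ _ => trivial, ?_⟩
      exact congrArg ModuleCat.Hom.hom
        (Injective.comp_factorThru (ModuleCat.ofHom u : _ ⟶ J) (ModuleCat.ofHom (lin i)))
    · refine mono_of_injective _ (Function.Injective.of_comp (f := W.eval) ?_)
      exact (congrArg (fun v : M.carrier →ₗ[A] J => Function.Injective v)
        (Family.eval_lift (W := W) f fun _ _ _ => trivial)).mpr hf

end Cofree

end GrMod
end GradedInjDim

/-! ### The functors `φ^*` and `φ_*` -/

namespace GradedInjDim

variable {k G H A : Type u} [Field k] [AddGroup G] [AddGroup H] [Ring A] [Algebra k A]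
variable {𝒜 : G → Submodule k A}
variable [h𝒜 : Fact (IsGrading 𝒜)] [SetLike.GradedMonoid 𝒜]

lemma FunData.fn_coeff {φ : G →+ H} {X : Type u} [AddCommGroup X] [Module k X] [Module A X]
    [IsScalarTower k A X] {D : FunData 𝒜 φ X} {ℬ : H → Submodule k A}
    [Fact (∀ h, ℬ h ≤ pushGrading φ 𝒜 h)] (f : (D.grMod ℬ).carrier) (x : G) :
    fn ((D.grMod ℬ).isGrading.coeff f (φ x)) x = fn f x := by
  change D.evalAt ℬ x ((D.grMod ℬ).isGrading.coeff f (φ x)) = D.evalAt ℬ x f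
  induction f using (D.grMod ℬ).isGrading.induction with
  | zero => rw [map_zero]; rfl
  | add f f' hf hf' => rw [map_add, Finsupp.add_apply, map_add, map_add, hf, hf']
  | of_mem h f hf =>
    by_cases hx : φ x = h
    · subst hx
      rw [(D.grMod ℬ).isGrading.coeff_self hf]
    · rw [(D.grMod ℬ).isGrading.coeff_of_ne hf hx, map_zero]
      exact (FunData.mem_comp_iff.1 hf x hx).symm

namespace GrMod

open FunData

namespace Family

variable {X : Type u} [AddCommGroup X] [Module k X] [Module A X] [IsScalarTower k A X]
  {X' : Type u} [AddCommGroup X'] [Module k X'] [Module A X'] [IsScalarTower k A X']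

lemma exists_mem_space_comp_eq (W : Family 𝒜 X) (W' : Family 𝒜 X') (φ : G →+ H)
    (e : X →ₗ[A] X') {f : GFun 𝒜 X'} (hf : f ∈ (W'.funData φ).space)
    (h : ∀ x, ∃ y ∈ W.sub x, e y = f x) :
    ∃ f' : GFun 𝒜 X, f' ∈ (W.funData φ).space ∧ ∀ x, e (f' x) = f x := by
  classical
  choose y hy hy' using h
  refine ⟨(fun x => if f x = 0 then 0 else y x : G → X), ⟨fun x => ?_, ?_⟩, fun x => ?_⟩
  · change ite _ _ _ ∈ _
    split_ifs
    exacts [Submodule.zero_mem _, hy x]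
  · exact hf.2.subset (Set.image_mono fun x hx h0 => hx (if_pos h0))
  · change e (ite _ _ _) = _
    split_ifs with h0
    · rw [map_zero, h0]
    · exact hy' x

/-- Homogeneous elements are determined by one value. -/
lemma ext_of_mem_comp {W : Family 𝒜 X} {g : G} {f f' : W.sum.carrier} (hf : f ∈ W.sum.comp g)
    (hf' : f' ∈ W.sum.comp g) (h : fn f g = fn f' g) : f = f' :=
  fn_injective fun x => by
    by_cases hx : x = g
    · rw [hx, h]
    · rw [FunData.mem_comp_iff.1 hf x hx, FunData.mem_comp_iff.1 hf' x hx]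

end Family

variable (φ : G →+ H)

/-- The family with `W g = X_{φ g}`. -/
def pullFamily (X : GrMod (pushGrading φ 𝒜)) : Family 𝒜 X.carrier where
  sub g := X.comp (φ g)
  smul_mem {g g' a x} ha hx := by
    rw [map_add]
    exact X.smul_mem (mem_pushGrading_of_mem rfl ha) hx

/-- The homogeneous components as a family. -/
def family (M : GrMod 𝒜) : Family 𝒜 M.carrier where
  sub := M.comp
  smul_mem := M.smul_mem

/-- The `H`-graded module with the component `∏_{φ g = h} W g` of degree `h`. -/
noncomputable abbrev Family.coind {X : Type u} [AddCommGroup X] [Module k X] [Module A X]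
    [IsScalarTower k A X] (W : Family 𝒜 X) : GrMod (pushGrading φ 𝒜) :=
  (W.funData φ).grMod (pushGrading φ 𝒜)

/-- A morphism which is homogeneous for the families `W` and `W'` acts on functions. -/
lemma Family.comp_mem_space {X : Type u} [AddCommGroup X] [Module k X] [Module A X]
    [IsScalarTower k A X] {X' : Type u} [AddCommGroup X'] [Module k X'] [Module A X']
    [IsScalarTower k A X'] {W : Family 𝒜 X} {W' : Family 𝒜 X'} {φ : G →+ H} {e : X →ₗ[A] X'}
    (he : ∀ g, ∀ x ∈ W.sub g, e x ∈ W'.sub g) (F : GFun 𝒜 X) (hF : F ∈ (W.funData φ).space) :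
    (fun x => e (F x) : G → X') ∈ (W'.funData φ).space :=
  ⟨fun g => he _ _ (hF.1 g), hF.2.subset (Set.image_mono fun x hx h0 => hx (by
    change e (F x) = 0
    rw [h0, map_zero]))⟩

/-- The action of `φ^*` on morphisms. -/
noncomputable def pullMap {X Y : GrMod (pushGrading φ 𝒜)} (f : X ⟶ Y) :
    (pullFamily φ X).sum ⟶ (pullFamily φ Y).sum :=
  FunData.map (lin f)
    (Family.comp_mem_space (W' := pullFamily φ Y) fun g x hx => f.map_mem (φ g) x hx)

lemma fn_pullMap {X Y : GrMod (pushGrading φ 𝒜)} (f : X ⟶ Y) (F : (pullFamily φ X).sum.carrier)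
    (x : G) : fn (lin (pullMap φ f) F) x = lin f (fn F x) := rfl

open scoped Classical in
/-- The function supported at `x` whose value is the component of `n` of degree `φ x`. -/
noncomputable def pullSingle (N : GrMod (pushGrading φ 𝒜)) (x : G) :
    N.carrier →ₗ[k] (pullFamily φ N).sum.carrier where
  toFun n := toElem (D := (pullFamily φ N).funData (AddMonoidHom.id G))
    (Pi.single x (N.isGrading.coeff n (φ x)) : G → N.carrier)
    ⟨fun x' => by
      by_cases h : x' = x
      · subst h
        exact (congrArg (· ∈ N.comp (φ x')) (Pi.single_eq_same (M := fun _ => N.carrier) x' _)).mpr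
          (N.isGrading.coeff_mem n (φ x'))
      · exact (congrArg (· ∈ N.comp (φ x'))
          (Pi.single_eq_of_ne (M := fun _ => N.carrier) h _)).mpr (Submodule.zero_mem _),
    Set.Finite.image _ ((Set.finite_singleton x).subset Pi.support_single_subset)⟩
  map_add' n n' := FunData.fn_injective fun x' => by
    refine Eq.trans ?_ (congrFun (Pi.single_add (f := fun _ : G => N.carrier) x _ _) x')
    rw [← Finsupp.add_apply, ← map_add]
    rfl
  map_smul' c n := FunData.fn_injective fun x' => by
    refine Eq.trans ?_ (congrFun (Pi.single_smul (f := fun _ : G => N.carrier) x c _) x')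
    rw [← Finsupp.smul_apply, ← map_smul]
    rfl

lemma fn_pullSingle_self (N : GrMod (pushGrading φ 𝒜)) (x : G) (n : N.carrier) :
    fn (pullSingle φ N x n) x = N.isGrading.coeff n (φ x) :=
  @Pi.single_eq_same G (fun _ => N.carrier) _ (Classical.decEq G) x _

lemma pullSingle_mem (N : GrMod (pushGrading φ 𝒜)) (x : G) (n : N.carrier) :
    pullSingle φ N x n ∈ (pullFamily φ N).sum.comp x :=
  fun x' h => @Pi.single_eq_of_ne G (fun _ => N.carrier) _ (Classical.decEq G) x x' h _

lemma pullSingle_eq_zero (N : GrMod (pushGrading φ 𝒜)) {x : G} {n : N.carrier}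
    (h : N.isGrading.coeff n (φ x) = 0) : pullSingle φ N x n = 0 :=
  Family.ext_of_mem_comp (pullSingle_mem φ N x n) (Submodule.zero_mem _)
    ((fn_pullSingle_self φ N x n).trans h)

lemma pullSingle_smul (N : GrMod (pushGrading φ 𝒜)) {g : G} {a : A} (ha : a ∈ 𝒜 g) (x : G)
    (n : N.carrier) : pullSingle φ N x (a • n) = a • pullSingle φ N (-g + x) n := by
  refine Family.ext_of_mem_comp (pullSingle_mem φ N x _) ?_ ?_
  · have := (pullFamily φ N).sum.smul_mem ha (pullSingle_mem φ N (-g + x) n)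
    rwa [add_neg_cancel_left] at this
  · rw [fn_smul_apply ha, fn_pullSingle_self, fn_pullSingle_self,
      coeff_smul N (mem_pushGrading_of_mem rfl ha), φ.map_add, φ.map_neg]

lemma pullMap_pullSingle {N N' : GrMod (pushGrading φ 𝒜)} (i : N ⟶ N') (x : G) (n : N.carrier) :
    lin (pullMap φ i) (pullSingle φ N x n) = pullSingle φ N' x (lin i n) :=
  Family.ext_of_mem_comp (Hom.map_mem _ _ _ (pullSingle_mem φ N x n)) (pullSingle_mem φ N' x _) (by
    rw [fn_pullMap, fn_pullSingle_self, fn_pullSingle_self, lin_coeff])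

/-- The functor `φ^*`, right adjoint to `φ_!`, given by `φ^*(X)_g = X_{φ g}`. -/
noncomputable def pullback (𝒜 : G → Submodule k A) [h𝒜 : Fact (IsGrading 𝒜)]
    [SetLike.GradedMonoid 𝒜] : GrMod (pushGrading φ 𝒜) ⥤ GrMod 𝒜 where
  obj X := (pullFamily φ X).sum
  map f := pullMap φ f

/-- The functor `φ_*`, right adjoint to `φ^*`, given by `φ_*(M)_h = ∏_{φ g = h} M_g`. -/
noncomputable def coind (𝒜 : G → Submodule k A) [h𝒜 : Fact (IsGrading 𝒜)]
    [SetLike.GradedMonoid 𝒜] : GrMod 𝒜 ⥤ GrMod (pushGrading φ 𝒜) where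
  obj M := M.family.coind φ
  map {M N} f := FunData.map (lin f)
    (Family.comp_mem_space (W' := N.family) fun g x hx => f.map_mem g x hx)

instance : (pullback φ 𝒜).Additive where
  map_add := hom_ext fun _ => fn_injective fun _ => rfl

instance : (coind φ 𝒜).Additive where
  map_add := hom_ext fun _ => fn_injective fun _ => rfl

instance : (pullback φ 𝒜).PreservesHomology :=
  preservesHomology_of_exact _ fun M N P f g _ h F hF => by
    obtain ⟨F', hF', e⟩ := Family.exists_mem_space_comp_eq (pullFamily φ M) (pullFamily φ N) _
      (lin f) (fn_mem F) fun x => exists_mem_comp_of_exact h ((fn_mem F).1 x)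
        (congrArg (fun F => fn F x) hF)
    exact ⟨toElem F' hF', fn_injective e⟩

instance : (coind φ 𝒜).PreservesHomology :=
  preservesHomology_of_exact _ fun M N P f g _ h F hF => by
    obtain ⟨F', hF', e⟩ := Family.exists_mem_space_comp_eq M.family N.family φ
      (lin f) (fn_mem F) fun x => exists_mem_comp_of_exact h ((fn_mem F).1 x)
        (congrArg (fun F => fn F x) hF)
    exact ⟨toElem F' hF', fn_injective e⟩

instance : (pushforward φ 𝒜).PreservesHomology :=
  preservesHomology_of_exact _ fun _ _ _ _ _ _ h => h

/-- Being right adjoint to the exact functor `φ_!`, the functor `φ^*` preserves injectives. -/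
instance injective_pullback (X : GrMod (pushGrading φ 𝒜)) [Injective X] :
    Injective ((pullback φ 𝒜).obj X) := by
  refine Family.injective_sum_iff.2 fun M N i hi u hu => ?_
  let u' : (pushforward φ 𝒜).obj M ⟶ X := ofLin (M := (pushforward φ 𝒜).obj M) u fun h m hm => by
    have hle : pushGrading φ M.comp h ≤ (X.comp h).comap (u.restrictScalars k) :=
      iSup₂_le fun g hg m hm => hg ▸ hu g m hm
    exact hle hm
  have : Mono ((pushforward φ 𝒜).map i) := mono_of_injective _ hi
  let w := Injective.factorThru u' ((pushforward φ 𝒜).map i)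
  have hw : (pushforward φ 𝒜).map i ≫ w = u' := Injective.comp_factorThru _ _
  exact ⟨lin w, fun g m hm => w.map_mem (φ g) m (mem_pushGrading_of_mem rfl hm), congrArg lin hw⟩

/-- If `⨁ g, W g` is injective, so is its image `W.coind φ` under the right adjoint `φ_*` of the
exact functor `φ^*`. -/
lemma Family.injective_coind {X : Type u} [AddCommGroup X] [Module k X] [Module A X]
    [IsScalarTower k A X] (W : Family 𝒜 X) [hW : Injective W.sum] : Injective (W.coind φ) := by
  refine ⟨fun {N N'} v i _ => ?_⟩
  -- the map `φ^*(N) → X` which corresponds to `v`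
  let u : (pullFamily φ N).sum.carrier →ₗ[A] X := liftLinear (pullFamily φ N).sum
    (fun g => evalAt _ _ g ∘ₗ (lin v).restrictScalars k ∘ₗ evalAt _ _ g)
    fun g a ha g' f hf => by
      change fn (lin v (fn (a • f) (g + g'))) (g + g') = a • fn (lin v (fn f g')) g'
      rw [fn_smul_apply ha, neg_add_cancel_left, map_smul, fn_smul_apply ha, neg_add_cancel_left]
  have hu : ∀ g, ∀ f ∈ (pullFamily φ N).sum.comp g, u f = fn (lin v (fn f g)) g :=
    fun g f hf => liftLinear_of_mem _ _ _ hf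
  have hi : Mono ((pullback φ 𝒜).map i) := inferInstance
  have hi' : Mono (pullMap φ i) := hi
  obtain ⟨w, hw, hwi⟩ := Family.injective_sum_iff.1 hW _ _ (pullMap φ i)
    (injective_of_mono _) u fun g f hf => by
      rw [hu g f hf]
      exact (fn_mem (lin v (fn f g))).1 g
  have hc : ∀ x n, N'.isGrading.coeff n (φ x) = 0 → w (pullSingle φ N' x n) = 0 := fun x n h => by
    rw [pullSingle_eq_zero φ N' h, map_zero]
  refine ⟨FunData.lift (fun x => w.restrictScalars k ∘ₗ pullSingle φ N' x)
    (fun n => ⟨fun g => ?_, ?_⟩)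
    (fun g a ha n x => ?_) (fun h n hn x hx => ?_), hom_ext fun n => fn_injective fun x => ?_⟩
  · exact hw g _ (pullSingle_mem φ N' _ _)
  · refine (N'.isGrading.coeff n).hasFiniteSupport.subset ?_
    rintro _ ⟨x, hx, rfl⟩ h0
    exact hx (hc x n h0)
  · change w (pullSingle φ N' x (a • n)) = a • w (pullSingle φ N' (-g + x) n)
    rw [pullSingle_smul φ N' ha, map_smul]
  · exact hc x n (N'.isGrading.coeff_of_ne hn hx)
  · change w (pullSingle φ N' x (lin i n)) = fn (lin v n) x
    rw [← pullMap_pullSingle, ← LinearMap.comp_apply, hwi, hu x _ (pullSingle_mem φ N x n),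
      fn_pullSingle_self, lin_coeff, fn_coeff]

/-- A graded module is isomorphic to the direct sum of its components. -/
lemma injective_family_sum (I : GrMod 𝒜) [Injective I] : Injective I.family.sum := by
  refine Family.injective_sum_iff.2 fun M N i hi u hu => ?_
  have := mono_of_injective i hi
  let u' : M ⟶ I := ofLin u hu
  exact ⟨lin (Injective.factorThru u' i), fun g m hm => Hom.map_mem _ g m hm,
    congrArg lin (Injective.comp_factorThru u' i)⟩

instance injective_coind (I : GrMod 𝒜) [Injective I] : Injective ((coind φ 𝒜).obj I) :=
  have := injective_family_sum I
  Family.injective_coind φ I.family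

/-- The unit of the adjunction between `φ_!` and `φ^*`. -/
noncomputable def pullUnit : 𝟭 (GrMod 𝒜) ⟶ pushforward φ 𝒜 ⋙ pullback φ 𝒜 where
  app M := Family.lift (W := pullFamily φ (pushObj φ M)) (LinearMap.id : M.carrier →ₗ[A] M.carrier)
    fun _ _ hm => mem_pushGrading_of_mem rfl hm
  naturality _ _ f := hom_ext fun m => fn_injective fun x => (lin_coeff f m x).symm

/-- The projection of `φ^*φ_!(M)_g = ⨁_{φ g' = φ g} M_{g'}` to the summand `M_g`. -/
noncomputable def pullRetractionLin (M : GrMod 𝒜) :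
    (pullFamily φ (pushObj φ M)).sum.carrier →ₗ[A] M.carrier :=
  liftLinear (pullFamily φ (pushObj φ M)).sum
    (fun g =>
      { toFun := fun f => M.isGrading.coeff (fn f g :) g
        map_add' := fun f f' => congrArg (fun c : G →₀ M.carrier => c g)
          (map_add M.isGrading.coeff (fn f g :) (fn f' g :))
        map_smul' := fun c f => congrArg (fun c : G →₀ M.carrier => c g)
          (map_smul M.isGrading.coeff c (fn f g :)) })
    fun g a ha g' f hf => by
      change M.isGrading.coeff (fn (a • f) (g + g') :) (g + g') =
        a • M.isGrading.coeff (fn f g' :) g'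
      rw [fn_smul_apply ha, neg_add_cancel_left]
      exact (coeff_smul M ha _ _).trans (by rw [neg_add_cancel_left])

lemma pullRetractionLin_of_mem (M : GrMod 𝒜) {g : G}
    {f : (pullFamily φ (pushObj φ M)).sum.carrier}
    (hf : f ∈ (pullFamily φ (pushObj φ M)).sum.comp g) :
    pullRetractionLin φ M f = M.isGrading.coeff (fn f g :) g :=
  liftLinear_of_mem _ _ _ hf

/-- The natural projection `φ^*φ_!(M) → M`. -/
noncomputable def pullRetraction : pushforward φ 𝒜 ⋙ pullback φ 𝒜 ⟶ 𝟭 (GrMod 𝒜) where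
  app M := ofLin (M := (pullFamily φ (pushObj φ M)).sum) (N := M) (pullRetractionLin φ M)
    fun g f hf => by
      rw [pullRetractionLin_of_mem φ M hf]
      exact M.isGrading.coeff_mem _ g
  naturality M N f := lin_injective <| linear_ext fun g F hF =>
    (pullRetractionLin_of_mem φ N
      (Hom.map_mem ((pullback φ 𝒜).map ((pushforward φ 𝒜).map f)) g F hF)).trans
      ((lin_coeff f _ g).symm.trans (congrArg (lin f) (pullRetractionLin_of_mem φ M hF).symm))

lemma pullUnit_comp_pullRetraction (M : GrMod 𝒜) :
    (pullUnit φ).app M ≫ (pullRetraction φ).app M = 𝟙 M :=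
  lin_injective <| linear_ext fun g m hm => by
    change pullRetractionLin φ M (lin ((pullUnit φ).app M) m) = m
    refine (pullRetractionLin_of_mem φ M (Hom.map_mem ((pullUnit φ).app M) g m hm)).trans ?_
    change M.isGrading.coeff (M.isGrading.coeff m g) g = m
    rw [M.isGrading.coeff_self hm, M.isGrading.coeff_self hm]

/-- The inclusion of `φ_!(M)_h = ⨁_{φ g = h} M_g` into `φ_*(M)_h = ∏_{φ g = h} M_g`. -/
noncomputable def pushToCoind : pushforward φ 𝒜 ⟶ coind φ 𝒜 where
  app M := FunData.lift (N := pushObj φ M) (D := M.family.funData φ)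
    (fun x => (Finsupp.lapply x ∘ₗ M.isGrading.coeff : M.carrier →ₗ[k] M.carrier))
    (fun m => ⟨fun g => M.isGrading.coeff_mem m g,
      (Set.Finite.subset (M.isGrading.coeff m).hasFiniteSupport fun _ hx => hx).image φ⟩)
    (fun _ _ ha m x => coeff_smul M ha m x)
    (fun h m hm x hx => (M.isGrading.mem_pushGrading_iff φ h m).1 hm x hx)
  naturality _ _ f := hom_ext fun m => fn_injective fun x => (lin_coeff f m x).symm

/-- For `φ`-finite modules the direct sums and the products in the definitions of `φ_!` and `φ_*`
are finite. -/
lemma isIso_pushToCoind (M : GrMod 𝒜) (hM : PhiFinite φ M) : IsIso ((pushToCoind φ).app M) := by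
  refine isIso_of_bijective _ ⟨fun m m' h => ?_, fun f => ?_⟩
  · rw [← M.isGrading.sum_coeff m, ← M.isGrading.sum_coeff m']
    congr 1
    exact Finsupp.ext fun x => congrArg (fun f : ((coind φ 𝒜).obj M).carrier => fn f x) h
  · have hfin : (Function.support (fn f)).Finite := by
      refine ((fn_mem f).2.biUnion fun h _ => hM h).subset fun x hx => ?_
      refine Set.mem_biUnion (Set.mem_image_of_mem φ hx) ⟨fun h0 => hx ?_, rfl⟩
      have := (fn_mem f).1 x
      rwa [show M.family.sub x = ⊥ from h0, Submodule.mem_bot] at this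
    let F : G →₀ M.carrier := Finsupp.ofSupportFinite (fn f) hfin
    refine ⟨F.sum fun _ y => y, fn_injective fun x => ?_⟩
    change M.isGrading.coeff (F.sum fun _ y => y) x = F x
    have : M.isGrading.coeff (F.sum fun _ y => y) = F := by
      rw [Finsupp.sum, map_sum]
      refine Eq.trans (Finset.sum_congr rfl fun y _ => ?_) F.sum_single
      exact M.isGrading.coeff_of_mem ((fn_mem f).1 y)
    rw [this]

end GrMod
end GradedInjDim

/-! ### Injective modules over graded noetherian algebras -/

namespace GradedInjDim

variable {k G H A : Type u} [Field k] [AddGroup G] [AddGroup H] [Ring A] [Algebra k A]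
variable {𝒜 : G → Submodule k A}

namespace GrMod

/-- A submodule is graded if it contains the components of its elements. -/
def IsGradedSub (N : GrMod 𝒜) (P : Submodule A N.carrier) : Prop :=
  ∀ m ∈ P, ∀ g, N.isGrading.coeff m g ∈ P

/-- A graded submodule as a graded module. -/
def subObj (N : GrMod 𝒜) (P : Submodule A N.carrier) (hP : N.IsGradedSub P) : GrMod 𝒜 where
  carrier := P
  comp g := (N.comp g).comap (P.subtype.restrictScalars k)
  isGrading := by
    refine IsGrading.of_proj
      (fun g => ((Finsupp.lapply g : (G →₀ N.carrier) →ₗ[k] N.carrier) ∘ₗ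
        N.isGrading.coeff).restrict (p := P.restrictScalars k) (q := P.restrictScalars k)
          fun m hm => hP m hm g) ?_ ?_ ?_
    · exact fun g m hm => Subtype.ext (N.isGrading.coeff_self hm)
    · exact fun g g' hg m hm => Subtype.ext (N.isGrading.coeff_of_ne hm hg)
    · rintro ⟨m, hm⟩
      have : (⟨m, hm⟩ : P) = ∑ g ∈ (N.isGrading.coeff m).support,
          ⟨N.isGrading.coeff m g, hP m hm g⟩ := by
        refine Subtype.ext ?_
        rw [AddSubmonoidClass.coe_finsetSum]
        exact (N.isGrading.sum_coeff m).symm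
      rw [this]
      exact Submodule.sum_mem _ fun g _ =>
        Submodule.mem_iSup_of_mem g (N.isGrading.coeff_mem m g)
  smul_mem ha hm := N.smul_mem ha hm

lemma IsGradedSub.le_iSup {N : GrMod 𝒜} {P : Submodule A N.carrier} (hP : N.IsGradedSub P) :
    P.restrictScalars k ≤ ⨆ g, P.restrictScalars k ⊓ N.comp g := fun m hm => by
  rw [← N.isGrading.sum_coeff m]
  exact Submodule.sum_mem _ fun g _ =>
    Submodule.mem_iSup_of_mem g ⟨hP m hm g, N.isGrading.coeff_mem m g⟩

lemma isGradedSub_range {M N : GrMod 𝒜} (i : M ⟶ N) : N.IsGradedSub (LinearMap.range (lin i)) := by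
  rintro _ ⟨m, rfl⟩ g
  exact ⟨_, lin_coeff i m g⟩

lemma IsGradedSub.inf {N : GrMod 𝒜} {P Q : Submodule A N.carrier} (hP : N.IsGradedSub P)
    (hQ : N.IsGradedSub Q) : N.IsGradedSub (P ⊓ Q) :=
  fun m hm g => ⟨hP m hm.1 g, hQ m hm.2 g⟩

lemma IsGradedSub.sup {N : GrMod 𝒜} {P Q : Submodule A N.carrier} (hP : N.IsGradedSub P)
    (hQ : N.IsGradedSub Q) : N.IsGradedSub (P ⊔ Q) := by
  intro m hm g
  obtain ⟨p, hp, q, hq, rfl⟩ := Submodule.mem_sup.1 hm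
  rw [map_add]
  exact Submodule.add_mem_sup (hP p hp g) (hQ q hq g)

variable [h𝒜 : Fact (IsGrading 𝒜)]

lemma isGradedSub_span_singleton (N : GrMod 𝒜) {g : G} {m : N.carrier} (hm : m ∈ N.comp g) :
    N.IsGradedSub (Submodule.span A {m}) := by
  intro x hx g'
  obtain ⟨a, rfl⟩ := Submodule.mem_span_singleton.1 hx
  clear hx
  induction a using h𝒜.out.induction with
  | zero => simp
  | add a b ha hb => rw [add_smul, map_add]; exact Submodule.add_mem _ ha hb
  | of_mem g'' a ha =>
    by_cases h : g' = g'' + g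
    · subst h
      rw [N.isGrading.coeff_self (N.smul_mem ha hm)]
      exact Submodule.smul_mem _ _ (Submodule.mem_span_singleton_self m)
    · rw [N.isGrading.coeff_of_ne (N.smul_mem ha hm) h]
      exact Submodule.zero_mem _

variable [SetLike.GradedMonoid 𝒜]

section Baer

variable {X : Type u} [AddCommGroup X] [Module k X] [Module A X] [IsScalarTower k A X]

/-- The partially defined `A`-linear maps with graded domain which are homogeneous with respect
to the family `W`. -/
def Family.partialMaps (W : Family 𝒜 X) (N : GrMod 𝒜) : Set (N.carrier →ₗ.[A] X) :=
  {f | N.IsGradedSub f.domain ∧ ∀ g, ∀ m : f.domain, m.1 ∈ N.comp g → f m ∈ W.sub g}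

lemma Family.exists_le_maximal (W : Family 𝒜 X) {N : GrMod 𝒜} {f : N.carrier →ₗ.[A] X}
    (hf : f ∈ W.partialMaps N) : ∃ f', f ≤ f' ∧ Maximal (· ∈ W.partialMaps N) f' := by
  refine zorn_le_nonempty₀ _ (fun c hc hchain f₀ hf₀ => ?_) f hf
  have hd : DirectedOn (· ≤ ·) c := hchain.directedOn
  refine ⟨LinearPMap.sSup c hd, ⟨fun m hm g => ?_, fun g m hm => ?_⟩,
    fun f' hf' => LinearPMap.le_sSup hd hf'⟩
  · obtain ⟨f', hf', hm'⟩ := (LinearPMap.mem_domain_sSup_iff ⟨f₀, hf₀⟩ hd).1 hm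
    exact (LinearPMap.mem_domain_sSup_iff ⟨f₀, hf₀⟩ hd).2 ⟨f', hf', (hc hf').1 m hm' g⟩
  · obtain ⟨f', hf', hm'⟩ := (LinearPMap.mem_domain_sSup_iff ⟨f₀, hf₀⟩ hd).1 m.2
    have := (hc hf').2 g ⟨m, hm'⟩ hm
    rwa [(LinearPMap.le_sSup hd hf').2 (y := m) rfl] at this

/-- Gluing partially defined homogeneous maps. -/
lemma Family.sup_mem_partialMaps {W : Family 𝒜 X} {N : GrMod 𝒜} {f f' : N.carrier →ₗ.[A] X}
    (hf : f ∈ W.partialMaps N) (hf' : f' ∈ W.partialMaps N)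
    (h : ∀ (x : f.domain) (y : f'.domain), (x : N.carrier) = y → f x = f' y) :
    f.sup f' h ∈ W.partialMaps N := by
  refine ⟨hf.1.sup hf'.1, fun g m hm => ?_⟩
  obtain ⟨p, hp, q, hq, hpq⟩ := Submodule.mem_sup.1 m.2
  have hpq' : N.isGrading.coeff p g + N.isGrading.coeff q g = m.1 := by
    rw [← Finsupp.add_apply, ← map_add, hpq, N.isGrading.coeff_self hm]
  rw [LinearPMap.sup_apply h ⟨_, hf.1 p hp g⟩ ⟨_, hf'.1 q hq g⟩ m hpq']
  exact Submodule.add_mem _ (hf.2 g _ (N.isGrading.coeff_mem p g))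
    (hf'.2 g _ (N.isGrading.coeff_mem q g))

/-- A graded version of Baer's criterion: the injectivity of `⨁ g, W g` can be tested on finitely
generated modules. -/
lemma Family.injective_sum_of_finite (W : Family 𝒜 X)
    (h : ∀ (M N : GrMod 𝒜) (i : M ⟶ N), Module.Finite A N.carrier → Function.Injective (lin i) →
      ∀ u : M.carrier →ₗ[A] X, (∀ g, ∀ m ∈ M.comp g, u m ∈ W.sub g) →
        ∃ w : N.carrier →ₗ[A] X, (∀ g, ∀ m ∈ N.comp g, w m ∈ W.sub g) ∧ w ∘ₗ lin i = u) :
    Injective W.sum := by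
  refine Family.injective_sum_iff.2 fun M N i hi u hu => ?_
  let f₀ : N.carrier →ₗ.[A] X :=
    ⟨LinearMap.range (lin i), u ∘ₗ (LinearEquiv.ofInjective (lin i) hi).symm.toLinearMap⟩
  have hf₀ : ∀ m, f₀ ⟨lin i m, m, rfl⟩ = u m := fun m =>
    congrArg u ((LinearEquiv.ofInjective (lin i) hi).symm_apply_apply m)
  -- a maximal extension is defined on all homogeneous elements `m`, since its restriction to the
  -- intersection of its domain with `A • m` extends to `A • m`
  obtain ⟨f, hle, hmax⟩ := W.exists_le_maximal (f := f₀) (N := N) ⟨isGradedSub_range i, by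
    rintro g ⟨_, m, rfl⟩ hm
    rw [hf₀]
    exact hu g m (mem_comp_of_injective i hi hm)⟩
  have hdom : ∀ g, ∀ m ∈ N.comp g, m ∈ f.domain := by
    intro g m hm
    let C := Submodule.span A {m}
    have hC : N.IsGradedSub C := isGradedSub_span_singleton N hm
    have hfC := hmax.prop.1.inf hC
    have hle₁ : f.domain ⊓ C ≤ f.domain := inf_le_left
    have hle₂ : f.domain ⊓ C ≤ C := inf_le_right
    obtain ⟨w, hw, hwf⟩ := h (N.subObj _ hfC) (N.subObj C hC)
      (ofLin (M := N.subObj _ hfC) (N := N.subObj C hC) (Submodule.inclusion hle₂) fun _ _ h => h)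
      (inferInstanceAs (Module.Finite A (Submodule.span A {m})))
      (Submodule.inclusion_injective hle₂) (f.toFun ∘ₗ Submodule.inclusion hle₁)
      fun g x hx => hmax.prop.2 g _ hx
    have hag : ∀ (x : f.domain) (y : C), (x : N.carrier) = y → f x = w y := fun x y hxy =>
      (LinearMap.congr_fun hwf ⟨x.1, x.2, hxy ▸ y.2⟩).symm.trans
        (congrArg w (Subtype.ext hxy))
    have hmem := Family.sup_mem_partialMaps hmax.prop
      (f' := ⟨C, w⟩) ⟨hC, fun g x hx => hw g x hx⟩ hag
    exact (hmax.le_of_ge hmem (LinearPMap.left_le_sup _ _ _)).1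
      (Submodule.mem_sup_right (Submodule.mem_span_singleton_self m))
  have htop : ∀ m, m ∈ f.domain := fun m => by
    rw [← N.isGrading.sum_coeff m]
    exact Submodule.sum_mem _ fun g _ => hdom g _ (N.isGrading.coeff_mem m g)
  refine ⟨f.toFun ∘ₗ LinearMap.codRestrict f.domain LinearMap.id htop,
    fun g m hm => hmax.prop.2 g ⟨m, htop m⟩ hm, LinearMap.ext fun m => ?_⟩
  exact (hle.2 (x := ⟨lin i m, m, rfl⟩) (y := ⟨lin i m, htop _⟩) rfl).symm.trans (hf₀ m)

end Baer

/-- The module `M` with the shifted grading `g ↦ M_{g + l}`. -/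
def shiftObj (M : GrMod 𝒜) (l : G) : GrMod 𝒜 where
  carrier := M.carrier
  comp g := M.comp (g + l)
  isGrading := ⟨M.isGrading.indep.comp (add_left_injective l),
    ((Equiv.addRight l).iSup_comp (g := M.comp)).trans M.isGrading.iSup_eq_top⟩
  smul_mem {g g' a m} ha hm := by
    rw [add_assoc]
    exact M.smul_mem ha hm

/-- Maps of degree `l` to an injective module can be extended. -/
lemma exists_extension_of_degree (I : GrMod 𝒜) [Injective I] (l : G) {M N : GrMod 𝒜} (i : M ⟶ N)
    (hi : Function.Injective (lin i)) (u : M.carrier →ₗ[A] I.carrier)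
    (hu : ∀ g, ∀ m ∈ M.comp g, u m ∈ I.comp (g + l)) :
    ∃ w : N.carrier →ₗ[A] I.carrier, (∀ g, ∀ m ∈ N.comp g, w m ∈ I.comp (g + l)) ∧
      w ∘ₗ lin i = u := by
  let i' : M.shiftObj (-l) ⟶ N.shiftObj (-l) :=
    ofLin (M := M.shiftObj (-l)) (N := N.shiftObj (-l)) (lin (M := M) (N := N) i)
      fun g m hm => i.map_mem _ m hm
  let u' : M.shiftObj (-l) ⟶ I := ofLin (M := M.shiftObj (-l)) u fun g m hm => by
    have := hu _ m hm
    rwa [neg_add_cancel_right] at this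
  have : Mono i' := mono_of_injective _ hi
  refine ⟨lin (M := N.shiftObj (-l)) (Injective.factorThru u' i'), fun g m hm => ?_,
    congrArg lin (Injective.comp_factorThru u' i')⟩
  refine Hom.map_mem (Injective.factorThru u' i') (g + l) m (?_ : m ∈ N.comp (g + l + -l))
  rwa [add_neg_cancel_right]

variable (φ : G →+ H)

/-- The family `g ↦ φ_!(I)_{φ g}`. -/
def pushFamily (I : GrMod 𝒜) : Family 𝒜 I.carrier where
  sub g := pushGrading φ I.comp (φ g)
  smul_mem {g g' a x} ha hx := by
    rw [map_add]
    exact (pushObj φ I).smul_mem (mem_pushGrading_of_mem rfl ha) hx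

section DegreeComponents

variable {φ} {I M : GrMod 𝒜} (u : M.carrier →ₗ[A] I.carrier)

/-- The component of degree `l` of an `A`-linear map between graded modules. -/
noncomputable def degComp (l : G) : M.carrier →ₗ[A] I.carrier :=
  liftLinear M (fun g => Finsupp.lapply (g + l) ∘ₗ I.isGrading.coeff ∘ₗ u.restrictScalars k)
    fun g a ha g' m hm => by
      change I.isGrading.coeff (u (a • m)) (g + g' + l) = a • I.isGrading.coeff (u m) (g' + l)
      rw [map_smul, coeff_smul I ha, add_assoc, neg_add_cancel_left]

lemma degComp_of_mem (l : G) {g : G} {m : M.carrier} (hm : m ∈ M.comp g) :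
    degComp u l m = I.isGrading.coeff (u m) (g + l) :=
  liftLinear_of_mem _ _ _ hm

lemma finite_degComp_ne_zero (m : M.carrier) : {l | degComp u l m ≠ 0}.Finite := by
  induction m using M.isGrading.induction with
  | zero => simp
  | add x y hx hy =>
    refine (hx.union hy).subset fun l hl => ?_
    by_contra h
    simp only [Set.mem_union, Set.mem_ofPred_eq, not_or, not_not] at h
    exact hl (by rw [map_add, h.1, h.2, add_zero])
  | of_mem g m hm =>
    refine (((I.isGrading.coeff (u m)).hasFiniteSupport).preimage
      (add_right_injective g).injOn).subset fun l hl => ?_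
    change I.isGrading.coeff (u m) (g + l) ≠ 0
    rw [← degComp_of_mem u l hm]
    exact hl

/-- A map on a finitely generated module has only finitely many components. -/
lemma finite_degComp_ne [hM : Module.Finite A M.carrier] : {l | degComp u l ≠ 0}.Finite := by
  obtain ⟨s, hs⟩ := hM.fg_top
  refine (s.finite_toSet.biUnion fun m _ => finite_degComp_ne_zero u m).subset fun l hl => ?_
  by_contra h
  refine hl (LinearMap.ext_on hs fun m hm => ?_)
  by_contra h'
  exact h (Set.mem_biUnion hm h')

lemma eq_sum_degComp (s : Finset G) (hs : ∀ l, degComp u l ≠ 0 → l ∈ s) :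
    u = ∑ l ∈ s, degComp u l := by
  classical
  refine linear_ext fun g m hm => ?_
  rw [LinearMap.sum_apply]
  conv_lhs => rw [← I.isGrading.sum_coeff (u m)]
  have h : (I.isGrading.coeff (u m)).support ⊆ s.image (g + ·) := fun x hx => by
    refine Finset.mem_image.2 ⟨-g + x, hs _ fun h0 => ?_, add_neg_cancel_left _ _⟩
    refine Finsupp.mem_support_iff.1 hx ?_
    have := degComp_of_mem u (-g + x) hm
    rwa [h0, add_neg_cancel_left, LinearMap.zero_apply, eq_comm] at this
  rw [Finsupp.sum_of_support_subset _ h _ (by simp), Finset.sum_image (by simp)]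
  exact Finset.sum_congr rfl fun l _ => (degComp_of_mem u l hm).symm

end DegreeComponents

/-- If `A` is graded left noetherian then `φ^*φ_!` preserves injective modules: on a finitely
generated graded module a map of degrees in `ker φ` is a finite sum of homogeneous maps, which can
be extended one by one. -/
lemma injective_pushFamily_sum (hA : IsGradedLeftNoetherian 𝒜) (I : GrMod 𝒜) [Injective I] :
    Injective (pushFamily φ I).sum := by
  classical
  refine Family.injective_sum_of_finite _ fun M N i hN hi u hu => ?_
  have : Module.Finite A (LinearMap.range (lin i)) :=
    Module.Finite.iff_fg.2 (hA N hN _ (isGradedSub_range i).le_iSup)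
  have : Module.Finite A M.carrier := Module.Finite.equiv (LinearEquiv.ofInjective (lin i) hi).symm
  have hdeg : ∀ l, ∀ g, ∀ m ∈ M.comp g, degComp u l m ∈ I.comp (g + l) := fun l g m hm => by
    rw [degComp_of_mem u l hm]
    exact I.isGrading.coeff_mem _ _
  choose w hw hwi using fun l => exists_extension_of_degree I l i hi (degComp u l) (hdeg l)
  let s := (finite_degComp_ne u).toFinset
  have hs : ∀ l, l ∈ s ↔ degComp u l ≠ 0 := fun l => Set.Finite.mem_toFinset _
  have hker : ∀ l ∈ s, φ l = 0 := fun l hl => by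
    by_contra h
    refine (hs l).1 hl (linear_ext fun g m hm => ?_)
    rw [degComp_of_mem u l hm, LinearMap.zero_apply]
    refine (I.isGrading.mem_pushGrading_iff φ _ _).1 (hu g m hm) _ fun h' => h ?_
    rwa [map_add, add_eq_left] at h'
  refine ⟨∑ l ∈ s, w l, fun g m hm => ?_, ?_⟩
  · rw [LinearMap.sum_apply]
    exact Submodule.sum_mem _ fun l hl =>
      mem_pushGrading_of_mem (by rw [map_add, hker l hl, add_zero]) (hw l g m hm)
  · rw [eq_sum_degComp u s fun l hl => (hs l).2 hl, ← Finset.sum_congr rfl fun l _ => hwi l]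
    exact LinearMap.ext fun m => by simp only [LinearMap.comp_apply, LinearMap.sum_apply]

lemma injective_pullFamily_pushObj_sum (hA : IsGradedLeftNoetherian 𝒜) (I : GrMod 𝒜)
    [Injective I] :
    Injective (pullFamily φ (pushObj φ I)).sum :=
  injective_pushFamily_sum φ hA I

end GrMod
end GradedInjDim

/-! ### Equivariant functions with values in `Hom(V, X)` -/

namespace GradedInjDim

variable {k G H A : Type u} [Field k] [AddGroup G] [AddGroup H] [Ring A] [Algebra k A]
variable {𝒜 : G → Submodule k A} (φ : G →+ H)

/-- The element of the group algebra of `ker φ` which corresponds to `l`. -/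
noncomputable def tr (k : Type u) [Field k] (l : φ.ker) : MonoidAlgebra k (Multiplicative φ.ker) :=
  MonoidAlgebra.single (Multiplicative.ofAdd l) 1

lemma tr_add (l l' : φ.ker) : tr φ k (l + l') = tr φ k l * tr φ k l' := by
  rw [tr, tr, tr, MonoidAlgebra.single_mul_single, mul_one, ofAdd_add]

variable [h𝒜 : Fact (IsGrading 𝒜)] [SetLike.GradedMonoid 𝒜]

namespace GrMod

open FunData

section Twist

variable (V V' : Type u) [AddCommGroup V] [Module k V]
  [Module (MonoidAlgebra k (Multiplicative φ.ker)) V]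
  [IsScalarTower k (MonoidAlgebra k (Multiplicative φ.ker)) V] [AddCommGroup V'] [Module k V']
  [Module (MonoidAlgebra k (Multiplicative φ.ker)) V']
  [IsScalarTower k (MonoidAlgebra k (Multiplicative φ.ker)) V']

/-- The functions `f` on `G` with `f g : V → X_{φ g}` which are equivariant under `ker φ` and whose
support has finite image under `φ`. -/
def twistData (X : GrMod (pushGrading φ 𝒜)) : FunData 𝒜 φ (V →ₗ[k] X.carrier) where
  space :=
    { carrier := {f | (∀ g v, f g v ∈ X.comp (φ g)) ∧
        (∀ g (l : φ.ker) v, f (g + l) v = f g (tr φ k l • v)) ∧ (φ '' Function.support f).Finite}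
      add_mem' := fun {f f'} hf hf' => ⟨fun g v => Submodule.add_mem _ (hf.1 g v) (hf'.1 g v),
        fun g l v => congrArg₂ (· + ·) (hf.2.1 g l v) (hf'.2.1 g l v),
        (hf.2.2.union hf'.2.2).subset (by
          rw [← Set.image_union]
          exact Set.image_mono (Function.support_add _ _))⟩
      zero_mem' := ⟨fun g v => Submodule.zero_mem _, fun g l v => rfl, by
        rw [show Function.support (0 : GFun 𝒜 (V →ₗ[k] X.carrier)) = ∅ from Function.support_zero,
          Set.image_empty]
        exact Set.finite_empty⟩
      smul_mem' := fun c f hf => ⟨fun g v => Submodule.smul_mem _ c (hf.1 g v),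
        fun g l v => congrArg (c • ·) (hf.2.1 g l v),
        hf.2.2.subset (Set.image_mono (Function.support_const_smul_subset c f))⟩ }
  smul_mem g a ha f hf := by
    refine ⟨fun x v => ?_, fun x l v => ?_, ?_⟩
    · rw [GFun.smul_apply ha, LinearMap.smul_apply]
      have := X.smul_mem (mem_pushGrading_of_mem (φ := φ) rfl ha) (hf.1 (-g + x) v)
      rwa [← map_add, add_neg_cancel_left] at this
    · rw [GFun.smul_apply ha, GFun.smul_apply ha, LinearMap.smul_apply, LinearMap.smul_apply,
        ← add_assoc, hf.2.1]
    · refine (hf.2.2.image (φ g + ·)).subset ?_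
      rintro _ ⟨x, hx, rfl⟩
      refine ⟨φ (-g + x), ⟨-g + x, fun h => hx ?_, rfl⟩, by simp⟩
      rw [GFun.smul_apply ha, h, smul_zero]
  restrict_mem h f hf f' h₁ h₂ := by
    refine ⟨fun x v => ?_, fun x l v => ?_,
      hf.2.2.subset (Set.image_mono fun x hx h0 => hx ?_)⟩
    · by_cases hx : φ x = h
      · rw [h₁ x hx]
        exact hf.1 x v
      · rw [h₂ x hx]
        exact Submodule.zero_mem _
    · have hl : φ (x + l) = φ x := by rw [map_add, l.2, add_zero]
      by_cases hx : φ x = h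
      · rw [h₁ x hx, h₁ _ (hl.trans hx), hf.2.1]
      · rw [h₂ x hx, h₂ _ (by rwa [hl])]
        rfl
    · by_cases hx : φ x = h
      · rw [h₁ x hx, h0]
      · exact h₂ x hx
  finite f hf := hf.2.2

/-- The graded module of equivariant functions from `G` to `Hom_k(V, X)`. In degree `φ g` it is
`Hom_k(V, X_{φ g})`. -/
noncomputable abbrev twistObj (X : GrMod (pushGrading φ 𝒜)) : GrMod (pushGrading φ 𝒜) :=
  (twistData φ V X).grMod (pushGrading φ 𝒜)

variable {V V'}

/-- Composition of a `k`-linear map with an `A`-linear map and a `k`-linear map. -/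
def homMap {V V' X X' : Type u} [AddCommGroup V] [Module k V] [AddCommGroup V'] [Module k V']
    [AddCommGroup X] [Module k X] [Module A X] [IsScalarTower k A X] [AddCommGroup X'] [Module k X']
    [Module A X'] [IsScalarTower k A X'] (p : V' →ₗ[k] V) (e : X →ₗ[A] X') :
    (V →ₗ[k] X) →ₗ[A] (V' →ₗ[k] X') where
  toFun f := e.restrictScalars k ∘ₗ f ∘ₗ p
  map_add' _ _ := LinearMap.ext fun _ => map_add e _ _
  map_smul' a _ := LinearMap.ext fun _ => map_smul e a _

variable {φ}

/-- The functoriality of `twistObj` in both arguments. -/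
noncomputable def twistMap {X Y : GrMod (pushGrading φ 𝒜)}
    (p : V' →ₗ[MonoidAlgebra k (Multiplicative φ.ker)] V) (e : X ⟶ Y) :
    twistObj φ V X ⟶ twistObj φ V' Y :=
  FunData.map (homMap (p.restrictScalars k) (lin e)) fun f hf =>
    ⟨fun g v => e.map_mem _ _ (hf.1 g _), fun g l v => by
      change lin e (f (g + l) (p v)) = lin e (f g (p (tr φ k l • v)))
      rw [hf.2.1, map_smul p], hf.2.2.subset (Set.image_mono fun x hx h0 => hx (by
        change homMap (p.restrictScalars k) (lin e) (f x) = 0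
        rw [h0, map_zero]))⟩

lemma twist_ext {X : GrMod (pushGrading φ 𝒜)} {f f' : (twistObj φ V X).carrier}
    (h : ∀ x v, fn f x v = fn f' x v) : f = f' :=
  fn_injective fun x => LinearMap.ext (h x)

variable (φ) (V) in
/-- `twistObj` as a functor of the graded module. -/
noncomputable def twist (𝒜 : G → Submodule k A) [h𝒜 : Fact (IsGrading 𝒜)]
    [SetLike.GradedMonoid 𝒜] : GrMod (pushGrading φ 𝒜) ⥤ GrMod (pushGrading φ 𝒜) where
  obj X := twistObj φ V X
  map e := twistMap LinearMap.id e

instance : (twist φ V 𝒜).Additive where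
  map_add := hom_ext fun _ => twist_ext fun _ _ => rfl

variable (𝒜) in
/-- The functoriality of `twist` in the module `V`. -/
noncomputable def twistTrans (p : V' →ₗ[MonoidAlgebra k (Multiplicative φ.ker)] V) :
    twist φ V 𝒜 ⟶ twist φ V' 𝒜 where
  app X := twistMap p (𝟙 X)
  naturality _ _ _ := hom_ext fun _ => twist_ext fun _ _ => rfl

section Exact

variable {V'' : Type u} [AddCommGroup V''] [Module k V'']
  [Module (MonoidAlgebra k (Multiplicative φ.ker)) V'']
  [IsScalarTower k (MonoidAlgebra k (Multiplicative φ.ker)) V'']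
  (i : V' →ₗ[MonoidAlgebra k (Multiplicative φ.ker)] V)
  (p : V →ₗ[MonoidAlgebra k (Multiplicative φ.ker)] V'') (X : GrMod (pushGrading φ 𝒜))

lemma twistMap_injective (hp : Function.Surjective p) :
    Function.Injective (lin (twistMap p (𝟙 X))) := fun f f' h => twist_ext fun x v => by
  obtain ⟨v, rfl⟩ := hp v
  exact LinearMap.congr_fun (congrArg (fun F => fn F x) h) v

lemma twistMap_exact (hp : Function.Surjective p) (hip : LinearMap.range i = LinearMap.ker p)
    (f : (twistObj φ V X).carrier) (hf : lin (twistMap i (𝟙 X)) f = 0) :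
    ∃ f', lin (twistMap p (𝟙 X)) f' = f := by
  have hle : ∀ x, LinearMap.ker (p.restrictScalars k) ≤ LinearMap.ker (fn f x) := fun x v hv => by
    have hv' : v ∈ LinearMap.ker p := hv
    rw [← hip] at hv'
    obtain ⟨v, rfl⟩ := hv'
    exact LinearMap.congr_fun (congrArg (fun F => fn F x) hf) v
  have hd : ∀ x, ∃ d : V'' →ₗ[k] X.carrier, ∀ v, d (p v) = fn f x v := fun x => by
    obtain ⟨s, hs⟩ := (p.restrictScalars k).exists_rightInverse_of_surjective
      (LinearMap.range_eq_top.2 hp)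
    refine ⟨fn f x ∘ₗ s, fun v => ?_⟩
    have : s (p v) - v ∈ LinearMap.ker (p.restrictScalars k) := by
      rw [LinearMap.mem_ker, map_sub, sub_eq_zero]
      exact LinearMap.congr_fun hs (p v)
    have := hle x this
    rwa [LinearMap.mem_ker, map_sub, sub_eq_zero] at this
  choose d hd using hd
  refine ⟨toElem (d : GFun 𝒜 (V'' →ₗ[k] X.carrier)) ⟨fun g v => ?_, fun g l v => ?_, ?_⟩,
    twist_ext fun x v => hd x v⟩
  · obtain ⟨v, rfl⟩ := hp v
    exact (congrArg (· ∈ X.comp (φ g)) (hd g v)).mpr ((fn_mem f).1 g v)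
  · obtain ⟨v, rfl⟩ := hp v
    refine (hd _ v).trans (((fn_mem f).2.1 g l v).trans ?_)
    rw [← map_smul]
    exact (hd g _).symm
  · refine (fn_mem f).2.2.subset (Set.image_mono fun x hx h0 => hx (LinearMap.ext fun v => ?_))
    obtain ⟨v, rfl⟩ := hp v
    refine (hd x v).trans ?_
    rw [h0]
    rfl

/-- An equivariant function is determined by its values at representatives of the cosets of
`ker φ`, and these can be prescribed. -/
lemma twistMap_surjective (hi : Function.Injective i) :
    Function.Surjective (lin (twistMap i (𝟙 X))) := fun f => by
  obtain ⟨r, hr⟩ := (i.restrictScalars k).exists_leftInverse_of_injective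
    (LinearMap.ker_eq_bot.2 hi)
  have hr' : ∀ v, r (i v) = v := LinearMap.congr_fun hr
  -- `σ (φ g)` represents the coset of `g`
  let σ : H → G := Function.invFun φ
  have hσ : ∀ g, φ (σ (φ g)) = φ g := fun g => Function.invFun_eq ⟨g, rfl⟩
  let l : G → φ.ker := fun g => ⟨-σ (φ g) + g, by
    rw [AddMonoidHom.mem_ker, map_add, map_neg, hσ, neg_add_cancel]⟩
  have hl : ∀ g, σ (φ g) + l g = g := fun g => add_neg_cancel_left _ _
  have hl' : ∀ g (m : φ.ker), l (g + m) = l g + m := fun g m => by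
    have hm : φ (g + m) = φ g := by rw [map_add, m.2, add_zero]
    refine Subtype.ext ?_
    change -σ (φ (g + m)) + (g + m) = -σ (φ g) + g + m
    rw [hm, add_assoc]
  let F : GFun 𝒜 (V →ₗ[k] X.carrier) := fun g => fn f (σ (φ g)) ∘ₗ r ∘ₗ
    (Module.toModuleEnd k V (tr φ k (l g)) : V →ₗ[k] V)
  have hF : ∀ g v, F g v = fn f (σ (φ g)) (r (tr φ k (l g) • v)) := fun g v => rfl
  refine ⟨toElem F ⟨fun g v => ?_, fun g m v => ?_, ?_⟩, twist_ext fun x v => ?_⟩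
  · have := (fn_mem f).1 (σ (φ g)) (r (tr φ k (l g) • v))
    rwa [hσ g] at this
  · rw [hF, hF, hl', show φ (g + m) = φ g by rw [map_add, m.2, add_zero], tr_add, mul_smul]
  · refine (fn_mem f).2.2.subset ?_
    rintro _ ⟨x, hx, rfl⟩
    refine ⟨σ (φ x), fun h0 => hx (LinearMap.ext fun v => ?_), hσ x⟩
    rw [hF, h0]
    rfl
  · change F x (i v) = fn f x v
    rw [hF, ← map_smul, hr', ← (fn_mem f).2.1, hl]

end Exact

end Twist

end GrMod
end GradedInjDim

/-! ### Injectivity of modules of equivariant functions -/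

namespace GradedInjDim

variable {k G H A : Type u} [Field k] [AddGroup G] [AddGroup H] [Ring A] [Algebra k A]
variable {𝒜 : G → Submodule k A} (φ : G →+ H)
variable [h𝒜 : Fact (IsGrading 𝒜)] [SetLike.GradedMonoid 𝒜]

namespace GrMod

open FunData

/-- The morphisms `N ⟶ φ_*φ^*(X)` as families of `k`-linear maps `N → X`, see `FunData.lift`. -/
def homSpace (N X : GrMod (pushGrading φ 𝒜)) : Submodule k (G → N.carrier →ₗ[k] X.carrier) where
  carrier := {ψ | (∀ x n, ψ x n ∈ X.comp (φ x)) ∧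
    (∀ g, ∀ a ∈ 𝒜 g, ∀ n x, ψ x (a • n) = a • ψ (-g + x) n) ∧
    ∀ h, ∀ n ∈ N.comp h, ∀ x, φ x ≠ h → ψ x n = 0}
  add_mem' := fun {_ _} h h' => ⟨fun x n => Submodule.add_mem _ (h.1 x n) (h'.1 x n),
    fun g a ha n x => (congrArg₂ (· + ·) (h.2.1 g a ha n x) (h'.2.1 g a ha n x)).trans
      (smul_add a _ _).symm,
    fun d n hn x hx => (congrArg₂ (· + ·) (h.2.2 d n hn x hx) (h'.2.2 d n hn x hx)).trans
      (add_zero 0)⟩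
  zero_mem' := ⟨fun _ _ => Submodule.zero_mem _, fun _ a _ _ _ => (smul_zero a).symm,
    fun _ _ _ _ _ => rfl⟩
  smul_mem' := fun c _ h => ⟨fun x n => Submodule.smul_mem _ c (h.1 x n),
    fun g a ha n x => (congrArg (c • ·) (h.2.1 g a ha n x)).trans (smul_comm c a _),
    fun d n hn x hx => (congrArg (c • ·) (h.2.2 d n hn x hx)).trans (smul_zero c)⟩

variable {φ} {N N' X : GrMod (pushGrading φ 𝒜)}

lemma homSpace_apply_eq_zero {ψ : G → N.carrier →ₗ[k] X.carrier} (hψ : ψ ∈ homSpace φ N X)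
    {x : G} {n : N.carrier} (h : N.isGrading.coeff n (φ x) = 0) : ψ x n = 0 := by
  rw [← N.isGrading.sum_coeff n, Finsupp.sum, map_sum]
  refine Finset.sum_eq_zero fun d hd => hψ.2.2 d _ (N.isGrading.coeff_mem n d) x ?_
  rintro rfl
  exact Finsupp.mem_support_iff.1 hd h

lemma homSpace_finite {ψ : G → N.carrier →ₗ[k] X.carrier} (hψ : ψ ∈ homSpace φ N X)
    (n : N.carrier) : (φ '' {x | ψ x n ≠ 0}).Finite := by
  refine (N.isGrading.coeff n).hasFiniteSupport.subset ?_
  rintro _ ⟨x, hx, rfl⟩ h0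
  exact hx (homSpace_apply_eq_zero hψ h0)

/-- Families of linear maps can be extended if `φ^*(X)`, and therefore `φ_*φ^*(X)`, is injective. -/
lemma exists_homSpace_extension [Injective (pullFamily φ X).sum] (i : N ⟶ N')
    (hi : Function.Injective (lin i)) {ψ : G → N.carrier →ₗ[k] X.carrier}
    (hψ : ψ ∈ homSpace φ N X) :
    ∃ ψ' ∈ homSpace φ N' X, ∀ x n, ψ' x (lin i n) = ψ x n := by
  have := Family.injective_coind φ (pullFamily φ X)
  have := mono_of_injective i hi
  let u : N ⟶ (pullFamily φ X).coind φ := FunData.lift ψ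
    (fun n => ⟨fun g => hψ.1 g n, homSpace_finite hψ n⟩) hψ.2.1 hψ.2.2
  let w := Injective.factorThru u i
  have hw : i ≫ w = u := Injective.comp_factorThru u i
  refine ⟨fun x => evalAt ((pullFamily φ X).funData φ) (pushGrading φ 𝒜) x ∘ₗ
    (lin w).restrictScalars k, ⟨fun x n => (fn_mem (lin w n)).1 x, fun g a ha n x => ?_,
    fun d n hn x hx => mem_comp_iff.1 (w.map_mem d n hn) x hx⟩, fun x n => ?_⟩
  · change fn (lin w (a • n)) x = a • fn (lin w n) (-g + x)
    rw [map_smul, fn_smul_apply ha]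
  · exact congrArg (fun v : N ⟶ (pullFamily φ X).coind φ => fn (lin v n) x) hw

/-- The action of `ker φ` by translation. -/
def translate (N X : GrMod (pushGrading φ 𝒜)) :
    Representation k (Multiplicative φ.ker) (homSpace φ N X) where
  toFun l :=
    { toFun := fun ψ => ⟨fun x => ψ.1 (x + l.toAdd), by
        have hl : ∀ x, φ (x + l.toAdd) = φ x := fun x => by
          rw [map_add, show φ l.toAdd = 0 from l.toAdd.2, add_zero]
        refine ⟨fun x n => hl x ▸ ψ.2.1 _ n, fun g a ha n x => ?_, fun d n hn x hx => ?_⟩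
        · exact (ψ.2.2.1 g a ha n _).trans (by rw [← add_assoc])
        · exact ψ.2.2.2 d n hn _ (by rwa [hl])⟩
      map_add' := fun _ _ => rfl
      map_smul' := fun _ _ => rfl }
  map_one' := LinearMap.ext fun ψ => Subtype.ext (funext fun x => congrArg ψ.1 (add_zero x))
  map_mul' l l' := LinearMap.ext fun ψ => Subtype.ext (funext fun x =>
    congrArg ψ.1 (add_assoc x _ _).symm)

noncomputable instance (N X : GrMod (pushGrading φ 𝒜)) :
    Module (MonoidAlgebra k (Multiplicative φ.ker)) (homSpace φ N X) :=
  Module.compHom _ (translate N X).asAlgebraHom.toRingHom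

instance (N X : GrMod (pushGrading φ 𝒜)) :
    IsScalarTower k (MonoidAlgebra k (Multiplicative φ.ker)) (homSpace φ N X) where
  smul_assoc c r ψ := by
    change (translate N X).asAlgebraHom (c • r) ψ = c • (translate N X).asAlgebraHom r ψ
    rw [map_smul, LinearMap.smul_apply]

lemma single_smul_apply (l : Multiplicative φ.ker) (ψ : homSpace φ N X) (x : G) :
    (MonoidAlgebra.single l (1 : k) • ψ).1 x = ψ.1 (x + l.toAdd) := by
  change ((translate N X).asAlgebraHom (MonoidAlgebra.single l (1 : k)) ψ).1 x = _
  rw [Representation.asAlgebraHom_single_one]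
  rfl

/-- Restriction along a morphism. -/
def restrictLin (i : N ⟶ N') (X : GrMod (pushGrading φ 𝒜)) :
    homSpace φ N' X →ₗ[k] homSpace φ N X where
  toFun ψ := ⟨fun x => ψ.1 x ∘ₗ (lin i).restrictScalars k, fun x n => ψ.2.1 x _,
    fun g a ha n x => by
      change ψ.1 x (lin i (a • n)) = a • ψ.1 (-g + x) (lin i n)
      rw [map_smul (lin i), ψ.2.2.1 g a ha],
    fun d n hn x hx => ψ.2.2.2 d _ (i.map_mem d n hn) x hx⟩
  map_add' _ _ := rfl
  map_smul' _ _ := rfl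

/-- Restriction along a morphism is equivariant. -/
noncomputable def restrictHom (i : N ⟶ N') (X : GrMod (pushGrading φ 𝒜)) :
    homSpace φ N' X →ₗ[MonoidAlgebra k (Multiplicative φ.ker)] homSpace φ N X :=
  MonoidAlgebra.equivariantOfLinearOfComm (restrictLin i X) fun l ψ => by
    refine Subtype.ext <| funext fun x => LinearMap.ext fun n => ?_
    rw [single_smul_apply]
    change (MonoidAlgebra.single l (1 : k) • ψ).1 x (lin i n) = _
    rw [single_smul_apply]
    rfl

variable {V : Type u} [AddCommGroup V] [Module k V]
  [Module (MonoidAlgebra k (Multiplicative φ.ker)) V]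
  [IsScalarTower k (MonoidAlgebra k (Multiplicative φ.ker)) V]

/-- The adjunction `Hom(N, twist V X) = Hom_{k[ker φ]}(V, Hom(N, φ_*φ^*(X)))`, from left to
right. -/
noncomputable def curryHom (u : N ⟶ twistObj φ V X) :
    V →ₗ[MonoidAlgebra k (Multiplicative φ.ker)] homSpace φ N X :=
  MonoidAlgebra.equivariantOfLinearOfComm
    { toFun := fun v => ⟨fun x => LinearMap.applyₗ v ∘ₗ
          evalAt (twistData φ V X) (pushGrading φ 𝒜) x ∘ₗ (lin u).restrictScalars k,
        fun x n => (fn_mem (lin u n)).1 x v, fun g a ha n x => by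
          change fn (lin u (a • n)) x v = a • fn (lin u n) (-g + x) v
          rw [map_smul (lin u), fn_smul_apply ha, LinearMap.smul_apply],
        fun d n hn x hx => by
          change fn (lin u n) x v = 0
          rw [mem_comp_iff.1 (u.map_mem d n hn) x hx, LinearMap.zero_apply]⟩
      map_add' := fun v v' => Subtype.ext <| funext fun x => LinearMap.ext fun n =>
        map_add (fn (lin u n) x) v v'
      map_smul' := fun c v => Subtype.ext <| funext fun x => LinearMap.ext fun n =>
        map_smul (fn (lin u n) x) c v }
    fun l v => Subtype.ext <| funext fun x => by
      rw [single_smul_apply]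
      exact LinearMap.ext fun n => ((fn_mem (lin u n)).2.1 x l.toAdd v).symm

/-- The adjunction `Hom(N, twist V X) = Hom_{k[ker φ]}(V, Hom(N, φ_*φ^*(X)))`, from right to
left. -/
noncomputable def uncurryHom
    (q : V →ₗ[MonoidAlgebra k (Multiplicative φ.ker)] homSpace φ N X) : N ⟶ twistObj φ V X :=
  FunData.lift (fun x => (LinearMap.proj x ∘ₗ (homSpace φ N X).subtype ∘ₗ
      q.restrictScalars k : V →ₗ[k] N.carrier →ₗ[k] X.carrier).flip)
    (fun n => ⟨fun g v => (q v).2.1 g n, fun g l v => by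
      change (q v).1 (g + l) n = (q (tr φ k l • v)).1 g n
      rw [map_smul]
      exact (congrArg (· n) (single_smul_apply (Multiplicative.ofAdd l) (q v) g)).symm, by
      refine (N.isGrading.coeff n).hasFiniteSupport.subset ?_
      rintro _ ⟨x, hx, rfl⟩ h0
      exact hx (LinearMap.ext fun v => homSpace_apply_eq_zero (q v).2 h0)⟩)
    (fun g a ha n x => LinearMap.ext fun v => (q v).2.2.1 g a ha n x)
    (fun d n hn x hx => LinearMap.ext fun v => (q v).2.2.2 d n hn x hx)

/-- If `V` is projective and `φ^*(X)` is injective, the adjunction exhibits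
`Hom(-, twist V X)` as a composition of exact functors. -/
lemma injective_twistObj [Module.Projective (MonoidAlgebra k (Multiplicative φ.ker)) V]
    [Injective (pullFamily φ X).sum] : Injective (twistObj φ V X) := by
  refine ⟨fun {N N'} u i _ => ?_⟩
  have hs : Function.Surjective (restrictHom i X) := fun ψ => by
    obtain ⟨ψ', hψ', h⟩ := exists_homSpace_extension i (injective_of_mono i) ψ.2
    exact ⟨⟨ψ', hψ'⟩, Subtype.ext <| funext fun x => LinearMap.ext fun n => h x n⟩
  obtain ⟨q, hq⟩ := Module.projective_lifting_property (restrictHom i X) (curryHom u) hs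
  refine ⟨uncurryHom q, hom_ext fun n => twist_ext fun x v => ?_⟩
  exact congrArg (fun ψ : homSpace φ N X => ψ.1 x n) (LinearMap.congr_fun hq v)

section Trivial

variable (e : V ≃ₗ[k] k) (he : ∀ (l : φ.ker) v, e (tr φ k l • v) = e v)

/-- The comparison of `M` and `twist V M` for a trivial one-dimensional module `V`. -/
noncomputable def toTwist (𝒜 : G → Submodule k A) [h𝒜 : Fact (IsGrading 𝒜)]
    [SetLike.GradedMonoid 𝒜] : 𝟭 (GrMod (pushGrading φ 𝒜)) ⟶ twist φ V 𝒜 where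
  app X := FunData.lift (N := X) (D := twistData φ V X)
    (fun x => (LinearMap.lsmul k X.carrier ∘ₗ e.toLinearMap).flip ∘ₗ
      Finsupp.lapply (φ x) ∘ₗ X.isGrading.coeff)
    (fun n => ⟨fun g v => Submodule.smul_mem _ _ (X.isGrading.coeff_mem n _), fun g l v => by
        change e v • X.isGrading.coeff n (φ (g + l)) = e (tr φ k l • v) • X.isGrading.coeff n (φ g)
        rw [he, map_add, l.2, add_zero], by
      refine (X.isGrading.coeff n).hasFiniteSupport.subset ?_
      rintro _ ⟨x, hx, rfl⟩ h0
      refine hx (LinearMap.ext fun v => ?_)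
      change e v • X.isGrading.coeff n (φ x) = 0
      rw [h0, smul_zero]⟩)
    (fun g a ha n x => LinearMap.ext fun v => by
      change e v • X.isGrading.coeff (a • n) (φ x) = a • e v • X.isGrading.coeff n (φ (-g + x))
      rw [coeff_smul X (mem_pushGrading_of_mem rfl ha), smul_comm, φ.map_add, φ.map_neg])
    (fun d n hn x hx => LinearMap.ext fun v => by
      change e v • X.isGrading.coeff n (φ x) = 0
      rw [X.isGrading.coeff_of_ne hn hx, smul_zero])
  naturality X Y f := hom_ext fun n => twist_ext fun x v => by
    change e v • Y.isGrading.coeff (lin f n) (φ x) = lin f (e v • X.isGrading.coeff n (φ x))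
    rw [← lin_coeff]
    exact (map_smul ((lin f).restrictScalars k) (e v) _).symm

lemma fn_toTwist (X : GrMod (pushGrading φ 𝒜)) (n : X.carrier) (x : G) (v : V) :
    fn (lin ((toTwist e he 𝒜).app X) n : (twistObj φ V X).carrier) x v =
      e v • X.isGrading.coeff n (φ x) := rfl

/-- The comparison is an isomorphism for graded modules which are supported on the image of `φ`,
in particular on the image of `φ_!`. -/
lemma isIso_toTwist (X : GrMod (pushGrading φ 𝒜)) (hX : ∀ h, h ∉ Set.range φ → X.comp h = ⊥) :
    IsIso ((toTwist e he 𝒜).app X) := by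
  have hX' : ∀ n : X.carrier, ∀ h, h ∉ Set.range φ → X.isGrading.coeff n h = 0 := fun n h hh => by
    have := X.isGrading.coeff_mem n h
    rwa [hX h hh, Submodule.mem_bot] at this
  have he1 : e (e.symm 1) = 1 := e.apply_symm_apply 1
  refine isIso_of_bijective _ ⟨fun n n' hn => ?_, fun f => ?_⟩
  · rw [← X.isGrading.sum_coeff n, ← X.isGrading.sum_coeff n']
    congr 1
    ext h
    by_cases hh : h ∈ Set.range φ
    · obtain ⟨x, rfl⟩ := hh
      have := LinearMap.congr_fun
        (congrArg (fun f : (twistObj φ V X).carrier => fn f x) hn) (e.symm 1)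
      rwa [fn_toTwist, fn_toTwist, he1, one_smul, one_smul] at this
    · rw [hX' n h hh, hX' n' h hh]
  · change (twistObj φ V X).carrier at f
    let σ : H → G := Function.invFun φ
    have hσ : ∀ g, φ (σ (φ g)) = φ g := fun g => Function.invFun_eq ⟨g, rfl⟩
    have hf : ∀ g v, fn f (σ (φ g)) v = fn f g v := fun g v => by
      have h := (fn_mem f).2.1 (σ (φ g)) ⟨-σ (φ g) + g, by
        rw [AddMonoidHom.mem_ker, map_add, map_neg, hσ, neg_add_cancel]⟩ v
      rw [add_neg_cancel_left] at h
      rw [h]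
      congr 1
      exact e.injective (he _ v).symm
    classical
    let F : H →₀ X.carrier := Finsupp.onFinset (fn_mem f).2.2.toFinset
      (fun h => if h ∈ Set.range φ then fn f (σ h) (e.symm 1) else 0) fun h hh => by
        rw [Set.Finite.mem_toFinset]
        have h1 : h ∈ Set.range φ := by
          by_contra h1
          exact hh (if_neg h1)
        obtain ⟨x, rfl⟩ := h1
        refine ⟨x, fun h0 => hh ?_, rfl⟩
        rw [if_pos ⟨x, rfl⟩, hf, h0]
        rfl
    have hF : ∀ x, F (φ x) = fn f x (e.symm 1) := fun x => (if_pos ⟨x, rfl⟩).trans (hf x _)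
    have hF' : ∀ h, F h ∈ X.comp h := fun h => by
      by_cases hh : h ∈ Set.range φ
      · obtain ⟨x, rfl⟩ := hh
        rw [hF]
        exact (fn_mem f).1 x _
      · rw [show F h = 0 from if_neg hh]
        exact Submodule.zero_mem _
    refine ⟨F.sum fun _ y => y, twist_ext fun x v => ?_⟩
    rw [fn_toTwist]
    have : X.isGrading.coeff (F.sum fun _ y => y) = F := by
      rw [Finsupp.sum, map_sum]
      refine Eq.trans (Finset.sum_congr rfl fun y _ => ?_) F.sum_single
      exact X.isGrading.coeff_of_mem (hF' y)
    rw [this, hF, ← map_smul]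
    congr 1
    apply e.injective
    rw [map_smul, he1, smul_eq_mul, mul_one]

end Trivial

end GrMod
end GradedInjDim

/-! ### Comparison of injective dimensions -/

namespace GradedInjDim

variable {k G H A : Type u} [Field k] [AddGroup G] [AddGroup H] [Ring A] [Algebra k A]
variable {𝒜 : G → Submodule k A} (φ : G →+ H)
variable [h𝒜 : Fact (IsGrading 𝒜)] [SetLike.GradedMonoid 𝒜]

namespace GrMod

/-- The complex `φ_!(K)`. -/
noncomputable abbrev pushComplex (K : CochainComplex (GrMod 𝒜) ℤ) :
    CochainComplex (GrMod (pushGrading φ 𝒜)) ℤ :=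
  ((pushforward φ 𝒜).mapHomologicalComplex (ComplexShape.up ℤ)).obj K

variable {φ}

lemma isZero_pushComplex {K : CochainComplex (GrMod 𝒜) ℤ} {i : ℤ} (h : IsZero (K.X i)) :
    IsZero ((pushComplex φ K).X i) :=
  (pushforward φ 𝒜).map_isZero h

/-- Injective resolutions of `φ_!(K)` give injective resolutions of `K`, since `K` is a direct
summand of `φ^*φ_!(K)`. -/
lemma hasInjResolutionLE_of_push {K : CochainComplex (GrMod 𝒜) ℤ} {a n : ℤ}
    (ha : ∀ i < a, IsZero (K.X i)) (h : HasInjResolutionLE (pushComplex φ K) n) :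
    HasInjResolutionLE K n := by
  have : HasDerivedCategory.{u + 1} (GrMod 𝒜) := HasDerivedCategory.standard _
  obtain ⟨J, f, hf, hJ, ⟨b, hb⟩, hn⟩ := h
  let P := (pullback φ 𝒜).mapHomologicalComplex (ComplexShape.up ℤ)
  have h₁ : HasInjResolutionLE (P.obj (pushComplex φ K)) n :=
    ⟨P.obj J, P.map f, inferInstance, fun i => have := hJ i; injective_pullback φ (J.X i),
      ⟨b, fun i hi => (pullback φ 𝒜).map_isZero (hb i hi)⟩,
      fun i hi => (pullback φ 𝒜).map_isZero (hn i hi)⟩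
  let ι : K ⟶ P.obj (pushComplex φ K) :=
    { f := fun i => (pullUnit φ).app (K.X i)
      comm' := fun i j _ => ((pullUnit φ).naturality (K.d i j)).symm }
  let r : P.obj (pushComplex φ K) ⟶ K :=
    { f := fun i => (pullRetraction φ).app (K.X i)
      comm' := fun i j _ => ((pullRetraction φ).naturality (K.d i j)).symm }
  have hιr : ι ≫ r = 𝟙 K := by
    exact HomologicalComplex.hom_ext _ _ fun i => pullUnit_comp_pullRetraction φ (K.X i)
  refine (h₁.homVanishesAbove.of_retract (DerivedCategory.Q.map ι) (DerivedCategory.Q.map r)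
    ?_).hasInjResolutionLE ha
  rw [← Functor.map_comp, hιr, CategoryTheory.Functor.map_id]

/-- If the cohomology of `K` is `φ`-finite then `φ_!(K) → φ_*(K)` is a quasi-isomorphism, and
`φ_*` is exact and preserves injective modules. -/
lemma HasInjResolutionLE.push_of_phiFinite {K : CochainComplex (GrMod 𝒜) ℤ} {n : ℤ}
    (hK : ∀ i, PhiFinite φ (K.homology i)) (h : HasInjResolutionLE K n) :
    HasInjResolutionLE (pushComplex φ K) n := by
  obtain ⟨I, f, hf, hI, ⟨b, hb⟩, hn⟩ := h
  let P := (coind φ 𝒜).mapHomologicalComplex (ComplexShape.up ℤ)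
  let t : pushComplex φ K ⟶ P.obj K :=
    (NatTrans.mapHomologicalComplex (pushToCoind φ) (ComplexShape.up ℤ)).app K
  have ht : QuasiIso t := ⟨fun i => by
    rw [quasiIsoAt_iff_isIso_homologyMap]
    have := isIso_pushToCoind φ (K.homology i) (hK i)
    change IsIso (ShortComplex.homologyMap ((K.sc i).mapNatTrans (pushToCoind φ)))
    rw [ShortComplex.homologyMap_mapNatTrans]
    have : IsIso ((pushToCoind φ).app (K.sc i).homology) := this
    infer_instance⟩
  exact ⟨P.obj I, t ≫ P.map f, inferInstance,
    fun i => have := hI i; injective_coind φ (I.X i),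
    ⟨b, fun i hi => (coind φ 𝒜).map_isZero (hb i hi)⟩,
    fun i hi => (coind φ 𝒜).map_isZero (hn i hi)⟩

section Twist

attribute [local instance] ModuleCat.moduleOfAlgebraModule
  ModuleCat.isScalarTower_of_algebra_moduleCat

/-- The functor `twist` turns short exact sequences of `k[ker φ]`-modules into short exact sequences
of complexes. -/
lemma twist_shortExact {S : ShortComplex (ModuleCat.{u} (MonoidAlgebra k (Multiplicative φ.ker)))}
    (hS : S.ShortExact) (K : CochainComplex (GrMod (pushGrading φ 𝒜)) ℤ) :
    ∃ S' : ShortComplex (CochainComplex (GrMod (pushGrading φ 𝒜)) ℤ), S'.ShortExact ∧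
      S'.X₁ = ((twist φ S.X₃ 𝒜).mapHomologicalComplex (ComplexShape.up ℤ)).obj K ∧
      S'.X₂ = ((twist φ S.X₂ 𝒜).mapHomologicalComplex (ComplexShape.up ℤ)).obj K ∧
      S'.X₃ = ((twist φ S.X₁ 𝒜).mapHomologicalComplex (ComplexShape.up ℤ)).obj K := by
  refine ⟨ShortComplex.mk
    ((NatTrans.mapHomologicalComplex (twistTrans 𝒜 S.g.hom) (ComplexShape.up ℤ)).app K)
    ((NatTrans.mapHomologicalComplex (twistTrans 𝒜 S.f.hom) (ComplexShape.up ℤ)).app K) ?_,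
    HomologicalComplex.shortExact_of_degreewise_shortExact _ fun i => ?_, rfl, rfl, rfl⟩
  · ext i
    refine hom_ext fun F => twist_ext fun x v => ?_
    change FunData.fn F x (S.g.hom (S.f.hom v)) = 0
    rw [show S.g.hom (S.f.hom v) = 0 from congrArg (fun q => q.hom v) S.zero, map_zero]
  · exact
      { exact := (exact_iff _).2 fun f hf => twistMap_exact S.f.hom S.g.hom (K.X i)
          hS.moduleCat_surjective_g hS.exact.moduleCat_range_eq_ker f hf
        mono_f := mono_of_injective _ (twistMap_injective S.g.hom (K.X i) hS.moduleCat_surjective_g)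
        epi_g := epi_of_surjective _
          (twistMap_surjective S.f.hom (K.X i) hS.moduleCat_injective_f) }

/-- Dimension shifting along a projective resolution of `V`. -/
lemma homVanishesAbove_twist [HasDerivedCategory.{u + 1} (GrMod (pushGrading φ 𝒜))]
    {K : CochainComplex (GrMod (pushGrading φ 𝒜)) ℤ}
    (hK : ∀ i, Injective (pullFamily φ (K.X i)).sum) {a n : ℤ} (ha : ∀ i < a, IsZero (K.X i))
    (hn : ∀ i > n, IsZero (K.X i)) (d : ℕ) :
    ∀ V : ModuleCat.{u} (MonoidAlgebra k (Multiplicative φ.ker)),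
      HasProjectiveDimensionLT V (d + 1) →
      HomVanishesAbove (((twist φ V 𝒜).mapHomologicalComplex (ComplexShape.up ℤ)).obj K)
        (n + d) := by
  have h₀ : ∀ V : ModuleCat.{u} (MonoidAlgebra k (Multiplicative φ.ker)), Projective V →
      HomVanishesAbove (((twist φ V 𝒜).mapHomologicalComplex (ComplexShape.up ℤ)).obj K) n := by
    intro V hV
    have : Module.Projective (MonoidAlgebra k (Multiplicative φ.ker)) V :=
      (IsProjective.iff_projective V).2 hV
    have := isKInjective_of_bounded
      (K := ((twist φ V 𝒜).mapHomologicalComplex (ComplexShape.up ℤ)).obj K) (a := a)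
      (fun i => have := hK i; injective_twistObj (V := V) (X := K.X i))
      fun i hi => (twist φ V 𝒜).map_isZero (ha i hi)
    exact homVanishesAbove_of_isKInjective fun i hi => (twist φ V 𝒜).map_isZero (hn i hi)
  induction d with
  | zero =>
    intro V hV
    have := h₀ V (projective_iff_hasProjectiveDimensionLT_one.2 hV)
    simpa using this
  | succ d ih =>
    intro V hV
    let S : ShortComplex (ModuleCat.{u} (MonoidAlgebra k (Multiplicative φ.ker))) :=
      ShortComplex.mk (kernel.ι (Projective.π V)) (Projective.π V) (kernel.condition _)
    have hS : S.ShortExact :=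
      { exact := S.exact_of_f_is_kernel (kernelIsKernel _)
        mono_f := inferInstanceAs (Mono (kernel.ι _))
        epi_g := inferInstanceAs (Epi (Projective.π V)) }
    have hP : Projective S.X₂ := inferInstanceAs (Projective (Projective.over V))
    have hV' := ih S.X₁ ((hS.hasProjectiveDimensionLT_X₃_iff d hP).1 hV)
    obtain ⟨S', hS', e₁, e₂, e₃⟩ := twist_shortExact (𝒜 := 𝒜) hS K
    have := HomVanishesAbove.of_shortExact (n := n + d) hS'
      (e₂ ▸ (h₀ S.X₂ hP).of_le (by lia)) (e₃ ▸ hV')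
    rw [e₁] at this
    rwa [Nat.cast_succ, ← add_assoc]

/-- For an object of `ModuleCat`, the action of `k` is obtained from the action of `k[ker φ]`, so
for the trivial module it agrees with the original one only up to the isomorphism given here. -/
lemma exists_equiv_of_equiv_trivial {V : ModuleCat.{u} (MonoidAlgebra k (Multiplicative φ.ker))}
    (ε : V ≃ₗ[MonoidAlgebra k (Multiplicative φ.ker)]
      (Representation.trivial k (Multiplicative φ.ker) k).asModule) :
    ∃ e : V ≃ₗ[k] k, ∀ (l : φ.ker) v, e (tr φ k l • v) = e v := by
  let ρ := Representation.trivial k (Multiplicative φ.ker) k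
  refine ⟨{ ε.toAddEquiv.trans ρ.asModuleEquiv.toAddEquiv with
    map_smul' := fun c v => ?_ }, fun l v => ?_⟩
  · change ρ.asModuleEquiv (ε (c • v)) = c • ρ.asModuleEquiv (ε v)
    rw [← algebraMap_smul (MonoidAlgebra k (Multiplicative φ.ker)) c v, map_smul ε,
      Representation.asModuleEquiv_map_smul, AlgHom.commutes]
    rfl
  · change ρ.asModuleEquiv (ε (tr φ k l • v)) = ρ.asModuleEquiv (ε v)
    rw [map_smul ε, Representation.asModuleEquiv_map_smul, tr,
      Representation.asAlgebraHom_single_one]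
    rfl

/-- The complex `φ_!(K)` is isomorphic to its twist by the trivial module. -/
lemma homVanishesAbove_of_twist [HasDerivedCategory.{u + 1} (GrMod (pushGrading φ 𝒜))]
    {V : ModuleCat.{u} (MonoidAlgebra k (Multiplicative φ.ker))} (e : V ≃ₗ[k] k)
    (he : ∀ (l : φ.ker) v, e (tr φ k l • v) = e v) {K : CochainComplex (GrMod 𝒜) ℤ} {n : ℤ}
    (h : HomVanishesAbove
      (((twist φ V 𝒜).mapHomologicalComplex (ComplexShape.up ℤ)).obj (pushComplex φ K)) n) :
    HomVanishesAbove (pushComplex φ K) n := by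
  let t : pushComplex φ K ⟶
      ((twist φ V 𝒜).mapHomologicalComplex (ComplexShape.up ℤ)).obj (pushComplex φ K) :=
    { f := fun i => (toTwist e he 𝒜).app ((pushComplex φ K).X i)
      comm' := fun i j _ => ((toTwist e he 𝒜).naturality ((pushComplex φ K).d i j)).symm }
  have : ∀ i, IsIso (t.f i) := fun i => isIso_toTwist e he _ fun h hh =>
    le_bot_iff.1 (iSup₂_le fun g hg => absurd ⟨g, hg⟩ hh)
  have : IsIso t := HomologicalComplex.Hom.isIso_of_components t
  exact (homVanishesAbove_iff_of_quasiIso t).2 h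

/-- If `A` is graded left noetherian, a resolution of `K` gives a resolution of `φ_!(K)` which is
longer by at most the projective dimension of `k` over `k[ker φ]`. -/
lemma HasInjResolutionLE.push_of_isGradedLeftNoetherian (hA : IsGradedLeftNoetherian 𝒜)
    {K : CochainComplex (GrMod 𝒜) ℤ} {a n : ℤ} (ha : ∀ i < a, IsZero (K.X i))
    (h : HasInjResolutionLE K n) (d : ℕ)
    (hd : projDimTrivial k (Multiplicative φ.ker) ≤ d) :
    HasInjResolutionLE (pushComplex φ K) (n + d) := by
  have : HasDerivedCategory.{u + 1} (GrMod (pushGrading φ 𝒜)) := HasDerivedCategory.standard _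
  obtain ⟨I, f, hf, hI, ⟨b, hb⟩, hn⟩ := h
  let f' : pushComplex φ K ⟶ pushComplex φ I :=
    ((pushforward φ 𝒜).mapHomologicalComplex (ComplexShape.up ℤ)).map f
  have hf' : QuasiIso f' := inferInstance
  obtain ⟨V, hV⟩ : ∃ V : ModuleCat.{u} (MonoidAlgebra k (Multiplicative φ.ker)),
    V = ModuleCat.of _ (Representation.trivial k (Multiplicative φ.ker) k).asModule := ⟨_, rfl⟩
  obtain ⟨e, he⟩ := exists_equiv_of_equiv_trivial (eqToIso hV).toLinearEquiv
  have hI' := homVanishesAbove_twist (φ := φ) (K := pushComplex φ I)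
    (fun i => have := hI i; injective_pullFamily_pushObj_sum φ hA (I.X i))
    (fun i hi => isZero_pushComplex (hb i hi)) (fun i hi => isZero_pushComplex (hn i hi)) d V
    ((projectiveDimension_le_iff V d).1 (hV ▸ hd))
  exact ((homVanishesAbove_iff_of_quasiIso f').2
    (homVanishesAbove_of_twist e he hI')).hasInjResolutionLE
      fun i hi => isZero_pushComplex (ha i hi)

end Twist

end GrMod

lemma projDimTrivial_ne_bot (k L : Type u) [Field k] [Group L] : projDimTrivial k L ≠ ⊥ := by
  intro h
  have h' := (projectiveDimension_eq_bot_iff _).1 h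
  have hs : Subsingleton (Representation.trivial k L k).asModule :=
    ModuleCat.subsingleton_of_isZero h'
  exact not_subsingleton k hs

end GradedInjDim

open GradedInjDim GradedInjDim.GrMod in
theorem mainTheorem4 {k G H A : Type u} [Field k] [AddCommGroup G] [DecidableEq G] [AddGroup H]
    [Ring A] [Algebra k A] (𝒜 : G → Submodule k A) [GradedAlgebra 𝒜] (φ : G →+ H)
    (R : CochainComplex (GrMod 𝒜) ℤ) (a b : ℤ)
    (hR : ∀ i : ℤ, i < a ∨ b < i → IsZero (R.X i)) :
    ((∀ i : ℤ, PhiFinite φ (R.homology i)) →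
      injDim R = injDim (((pushforward φ 𝒜).mapHomologicalComplex (ComplexShape.up ℤ)).obj R)) ∧
    (IsGradedLeftNoetherian 𝒜 →
      injDim R ≤ injDim (((pushforward φ 𝒜).mapHomologicalComplex (ComplexShape.up ℤ)).obj R) ∧
      injDim (((pushforward φ 𝒜).mapHomologicalComplex (ComplexShape.up ℤ)).obj R) ≤
        injDim R + castDim (projDimTrivial k (Multiplicative φ.ker))) := by
  have hint := DirectSum.Decomposition.isInternal 𝒜
  have : Fact (IsGrading 𝒜) := ⟨⟨hint.submodule_iSupIndep, hint.submodule_iSup_eq_top⟩⟩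
  have ha : ∀ i < a, IsZero (R.X i) := fun i hi => hR i (Or.inl hi)
  refine ⟨fun hfin => injDim_eq_of_forall_iff fun n =>
    ⟨HasInjResolutionLE.push_of_phiFinite hfin, hasInjResolutionLE_of_push ha⟩, fun hA =>
    ⟨injDim_le_of_forall_imp fun n => hasInjResolutionLE_of_push ha, ?_⟩⟩
  obtain ⟨d, hd⟩ := WithBot.ne_bot_iff_exists.1 (projDimTrivial_ne_bot k (Multiplicative φ.ker))
  obtain h | h | ⟨n, h, hn⟩ := injDim_cases R
  · rw [h, ← hd]
    exact le_top
  · -- `R` is acyclic, and therefore `φ_!(R)` is acyclic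
    have hR' := acyclic_of_injDim_eq_bot (injDim_eq_bot_iff.2 h)
    exact (injDim_eq_bot_of_acyclic (K := pushComplex φ R) fun i =>
      ShortComplex.Exact.map (hR' i) (pushforward φ 𝒜)).trans_le bot_le
  · rw [h, ← hd]
    induction d with
    | top => exact le_top
    | coe d =>
      exact injDim_le_coe (HasInjResolutionLE.push_of_isGradedLeftNoetherian hA ha hn d hd.ge)
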